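/- Write $u\times w=\det(u\mid w)$ for $u,w\in\mathbb R^2$. Polygons are convex, and their boundaries are oriented clockwise. **(1)** Let $X_\Sigma$ be a projective toric surface over $\mathbb C$, given by a complete fan $\Sigma$ in $\mathbb R^2$ with rays $\rho$, primitive ray generators $u_\rho$ and boundary curves $D_\rho$. For an $\mathbb R$-divisor $D=\sum_\rho a_\rho D_\rho$ put $P(D)=\{x\in\mathbb R^2:\langle u_\rho,x\rangle\ge -a_\rho\text{ for all }\rho\}$, and let the edge of $P(D)$ corresponding to $\rho$ be $\{x\in P(D):\langle u_\rho,x\rangle=-a_\rho\}$, which may be a point. Then $D$ is nef if and only if, for each ray $\rho$, the intersection number $D\cdot D_\rho$ equals the lattice length of the edge of $P(D)$ corresponding to $\rho$ (where the empty set has length $0$). Moreover, if $D$ is nef, all these edges are nonempty. **(2)** Let $\Omega\subset\mathbb R^2$ be a polygon with nonempty interior and rational vertices. The slopes of $\Omega$ are the primitive lattice vectors in the directions of its oriented edges; they are the primitive ray generators of a complete fan, with toric surface $Y$. For a polygon $S$ and $v\in\mathbb R^2$ let $\ell_S(v)=v\times p$, where $p\in S$ is such that $S\subset p+\{u:u\times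 v\ge0\}$; thus $\ell_S(v)=\max_{q\in S}v\times q$. Let $\Lambda\subset\mathbb R^2$ be a nonempty polygon, possibly degenerate to a point or to a segment (whose boundary is the segment traversed once in each direction), such that each oriented edge of $\Lambda$ is a positive multiple of a slope of $\Omega$. Let $\ell_\Omega(\partial\Lambda)$ be the sum of $\ell_\Omega(e)$ over the oriented edges $e$ of $\Lambda$. Put $$D_\Lambda=\sum_v\ell_\Lambda(v)D_v,\qquad D_\Omega=\sum_v\ell_\Omega(v)D_v,$$ the sums being over the slopes $v$ of $\Omega$. Then $D_\Lambda$ is nef, its polygon $P(D_\Lambda)$ is the rotation of $\Lambda$ by $90^\circ$ anticlockwise about the origin, it is the only nef torus-invariant $\mathbb R$-divisor with this polygon, and $$\ell_\Omega(\partial\Lambda)=D_\Lambda\cdot D_\Omega .$$ -/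

import Mathlib

/-! # Plane convex geometry -/

/-- The cross product `p × q = det (p | q)` on `ℝ²`. -/
def cross (p q : ℝ × ℝ) : ℝ := p.1 * q.2 - p.2 * q.1

/-- The dot product, that is, the pairing between `N_ℝ = ℝ²` and `M_ℝ = ℝ²`. -/
def dotR (p q : ℝ × ℝ) : ℝ := p.1 * q.1 + p.2 * q.2

/-- The rotation `(a, b) ↦ (-b, a)` of the plane by `90°` anticlockwise. -/
def perp (p : ℝ × ℝ) : ℝ × ℝ := (-p.2, p.1)

/-- A lattice vector as a real vector. -/
def toR (v : ℤ × ℤ) : ℝ × ℝ := ((v.1 : ℝ), (v.2 : ℝ))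

/-- Convex polygons: convex hulls of finite nonempty sets of points. Points and segments are
included as degenerate polygons. -/
def IsPolygon (S : Set (ℝ × ℝ)) : Prop :=
  ∃ V : Set (ℝ × ℝ), V.Finite ∧ V.Nonempty ∧ S = convexHull ℝ V

/-- Nondegenerate convex polygons with rational vertices. -/
def IsRationalPolygon (S : Set (ℝ × ℝ)) : Prop :=
  (∃ V : Finset (ℚ × ℚ),
    S = convexHull ℝ ((fun p : ℚ × ℚ => (((p.1 : ℝ), (p.2 : ℝ)) : ℝ × ℝ)) '' (V : Set (ℚ × ℚ)))) ∧
  (interior S).Nonempty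

/-- `p` is a point of `S` such that the halfplane `p + {u | u × v ≥ 0}`, which lies to the right of
the line through `p` in direction `v`, contains `S`. -/
def IsSupportPoint (S : Set (ℝ × ℝ)) (v p : ℝ × ℝ) : Prop :=
  p ∈ S ∧ ∀ q ∈ S, 0 ≤ cross (q - p) v

/-- The `S`-length `ℓ_S(v)` of a vector `v`. It equals `v × p` for every support point `p` of `S`
in direction `v`, see `omegaLength_eq`. -/
noncomputable def omegaLength (S : Set (ℝ × ℝ)) (v : ℝ × ℝ) : ℝ :=
  sSup ((fun q => cross v q) '' S)

theorem omegaLength_eq {S : Set (ℝ × ℝ)} {v p : ℝ × ℝ} (h : IsSupportPoint S v p) :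
    omegaLength S v = cross v p := by
  refine IsGreatest.csSup_eq ⟨⟨p, h.1, rfl⟩, ?_⟩
  rintro _ ⟨q, hq, rfl⟩
  have := h.2 q hq
  simp only [cross, Prod.fst_sub, Prod.snd_sub] at this ⊢
  linarith

/-- The edge vectors of a convex polygon whose boundary is oriented clockwise: the vectors `e ≠ 0`
such that the points of `S` on the supporting line in direction `e` (with `S` on its right) form a
segment from some `q` to `q + e`. A degenerate polygon which is a segment has two edge vectors,
opposite to each other. Distinct edges of a convex polygon have distinct edge vectors. -/
def edgeVectors (S : Set (ℝ × ℝ)) : Set (ℝ × ℝ) :=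
  {e | e ≠ 0 ∧ ∃ q, {p | IsSupportPoint S e p} = segment ℝ q (q + e)}

/-- The `Ω`-perimeter `ℓ_Ω(∂Λ)`: the sum of the `Ω`-lengths of the edge vectors of `Λ`. -/
noncomputable def omegaPerimeter (Ω Λ : Set (ℝ × ℝ)) : ℝ :=
  ∑ᶠ e ∈ edgeVectors Λ, omegaLength Ω e

/-- Every edge of `Λ` is parallel to an edge of `Ω` (both boundaries oriented clockwise, edges
taken with their orientation). -/
def EdgesParallel (Λ Ω : Set (ℝ × ℝ)) : Prop :=
  ∀ e ∈ edgeVectors Λ, ∃ e' ∈ edgeVectors Ω, SameRay ℝ e e'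

/-- The slopes of `Ω`: the primitive lattice vectors in the directions of the oriented edges. -/
def slopes (Ω : Set (ℝ × ℝ)) : Set (ℤ × ℤ) :=
  {v | IsCoprime v.1 v.2 ∧ ∃ e ∈ edgeVectors Ω, SameRay ℝ (toR v) e}

/-! # Complete fans in the plane

A complete fan in `N_ℝ = ℝ²` is given by the set `R` of the primitive generators of its rays. Its
two-dimensional cones are those spanned by two consecutive rays; its other cones are the rays and
the origin. -/

/-- The cone spanned by two lattice vectors. -/
def cone (u v : ℤ × ℤ) : Set (ℝ × ℝ) :=
  {x | ∃ a b : ℝ, 0 ≤ a ∧ 0 ≤ b ∧ x = a • toR u + b • toR v}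

/-- The determinant of two lattice vectors. -/
def crossZ (u v : ℤ × ℤ) : ℤ := u.1 * v.2 - u.2 * v.1

/-- `u` and `v`, in anticlockwise order, generate a two-dimensional cone of the fan. -/
def IsMaximalCone (R : Set (ℤ × ℤ)) (u v : ℤ × ℤ) : Prop :=
  u ∈ R ∧ v ∈ R ∧ 0 < crossZ u v ∧ ∀ w ∈ R, toR w ∈ cone u v → w = u ∨ w = v

/-- `R` is the set of primitive ray generators of a complete fan in the plane, that is, of the fan
of a projective toric surface: `R` is finite, consists of primitive vectors, and the
two-dimensional cones cover the plane. -/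
structure IsCompleteFan (R : Set (ℤ × ℤ)) : Prop where
  finite : R.Finite
  primitive : ∀ u ∈ R, IsCoprime u.1 u.2
  complete : ∀ x : ℝ × ℝ, ∃ u v, IsMaximalCone R u v ∧ x ∈ cone u v

/-! # Affine charts of a toric surface -/

/-- The pairing between `M = ℤ²` and `N = ℤ²`. -/
def pairing (m u : ℤ × ℤ) : ℤ := m.1 * u.1 + m.2 * u.2

/-- The semigroup `σ^∨ ∩ M` for the cone `σ` spanned by `u` and `v`. -/
def dualMonoid (u v : ℤ × ℤ) : AddSubmonoid (ℤ × ℤ) where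
  carrier := {m | 0 ≤ pairing m u ∧ 0 ≤ pairing m v}
  zero_mem' := by simp [pairing]
  add_mem' := by
    rintro a b ⟨h1, h2⟩ ⟨h3, h4⟩
    simp only [Set.mem_ofPred_eq, pairing, Prod.fst_add, Prod.snd_add] at *
    constructor <;> linarith

/-- The coordinate ring `ℂ[σ^∨ ∩ M]` of the affine chart `U_σ`. -/
abbrev ChartRing (u v : ℤ × ℤ) : Type := AddMonoidAlgebra ℂ (dualMonoid u v)

/-- The character `χ^m` as a function on the chart. -/
noncomputable def chi {u v : ℤ × ℤ} (m : dualMonoid u v) : ChartRing u v :=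
  AddMonoidAlgebra.single m 1

/-- The ideal of the boundary curve `D_v` in the chart of `Cone (u, v)`, generated by the
characters vanishing on it, that is, the `χ^m` with `⟨m, v⟩ > 0`. -/
noncomputable def boundaryIdeal (u v : ℤ × ℤ) : Ideal (ChartRing u v) :=
  Ideal.span {f | ∃ m : dualMonoid u v, 0 < pairing m v ∧ f = chi m}

/-- The ideal of the Cartier divisor `k • D_u` in the chart of `Cone (u, v)`, for
`k = |det (u, v)|`. It is principal, generated by `χ^m` for the only `m ∈ M` such that the divisor
of `χ^m` on the chart, which is `⟨m, u⟩ D_u + ⟨m, v⟩ D_v`, equals `k • D_u`. -/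
noncomputable def multipleIdeal (u v : ℤ × ℤ) : Ideal (ChartRing u v) :=
  Ideal.span {f | ∃ m : dualMonoid u v,
    pairing m u = |crossZ u v| ∧ pairing m v = 0 ∧ f = chi m}

/-- The local intersection number of `D_u` and `D_v` at the torus-fixed point of the chart of
`Cone (u, v)`: the length of the scheme-theoretic intersection of the Cartier divisor `k • D_u`
and the curve `D_v`, divided by `k`. -/
noncomputable def localIntersection (u v : ℤ × ℤ) : ℝ :=
  (Module.finrank ℂ (ChartRing u v ⧸ (multipleIdeal u v ⊔ boundaryIdeal u v)) : ℝ) /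
    (|crossZ u v| : ℤ)

/-! # Divisors and intersection numbers -/

/-- Torus-invariant `ℝ`-divisors `∑ a_ρ D_ρ` on the toric surface with ray generators `R`. -/
abbrev RDivisor (R : Set (ℤ × ℤ)) : Type := R → ℝ

open Classical in
/-- `D_ρ · D_τ` for different boundary curves: these meet, in exactly one point, if and only if
`ρ` and `τ` span a cone of the fan. -/
noncomputable def properIntersection {R : Set (ℤ × ℤ)} (ρ τ : R) : ℝ :=
  if IsMaximalCone R ρ τ ∨ IsMaximalCone R τ ρ then localIntersection ρ τ else 0

/-- A vector `m ∈ M` with `⟨m, u⟩ = 1`, if `u` is primitive. -/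
def bezout (u : ℤ × ℤ) : ℤ × ℤ := (Int.gcdA u.1 u.2, Int.gcdB u.1 u.2)

open Classical in
/-- `D_ρ · D_τ` for arbitrary boundary curves. The self-intersection `D_ρ · D_ρ` is computed by
replacing one factor by the linearly equivalent divisor
`D_ρ - div χ^m = - ∑_{τ ≠ ρ} ⟨m, u_τ⟩ D_τ`, where `⟨m, u_ρ⟩ = 1`. -/
noncomputable def boundaryIntersection {R : Set (ℤ × ℤ)} (ρ τ : R) : ℝ :=
  if ρ = τ then
    -∑ᶠ (κ : R) (_ : κ ≠ ρ), (pairing (bezout ρ) κ : ℝ) * properIntersection κ ρ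
  else properIntersection ρ τ

/-- The intersection number `D · E` of two `ℝ`-divisors. -/
noncomputable def intersection {R : Set (ℤ × ℤ)} (D E : RDivisor R) : ℝ :=
  ∑ᶠ (ρ : R) (τ : R), D ρ * E τ * boundaryIntersection ρ τ

open Classical in
/-- The boundary curve `D_ρ` as a divisor. -/
noncomputable def boundaryDivisor {R : Set (ℤ × ℤ)} (ρ : R) : RDivisor R := Pi.single ρ 1

/-- The order of vanishing along `D_u` of the rational function given by a Laurent polynomial. -/
noncomputable def ordAlong (u : ℤ × ℤ) (f : AddMonoidAlgebra ℂ (ℤ × ℤ)) : ℤ :=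
  sInf ((fun m => pairing m u) '' {m | f.coeff m ≠ 0})

/-- A torus-invariant divisor linearly equivalent to the closure `C` of the zero locus in the torus
of a Laurent polynomial `f`: it is `C - div f`, since `div f = C + ∑ ord_ρ(f) D_ρ`. -/
noncomputable def closureDivisor (R : Set (ℤ × ℤ)) (f : AddMonoidAlgebra ℂ (ℤ × ℤ)) :
    RDivisor R :=
  fun ρ => -(ordAlong ρ f : ℝ)

/-- A divisor is nef if its intersection number with every irreducible complete curve is
nonnegative. The irreducible curves are the boundary curves and the closures of the irreducible
curves in the torus, which are the zero loci of irreducible Laurent polynomials. -/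
def IsNef {R : Set (ℤ × ℤ)} (D : RDivisor R) : Prop :=
  (∀ ρ : R, 0 ≤ intersection D (boundaryDivisor ρ)) ∧
  ∀ f : AddMonoidAlgebra ℂ (ℤ × ℤ), Irreducible f → 0 ≤ intersection D (closureDivisor R f)

/-- The polytope `P(D) = {x ∈ M_ℝ | ⟨u_ρ, x⟩ ≥ -a_ρ for all ρ}`. -/
def polytope {R : Set (ℤ × ℤ)} (D : RDivisor R) : Set (ℝ × ℝ) :=
  {x | ∀ ρ : R, -D ρ ≤ dotR (toR ρ) x}

/-- The (possibly degenerate) edge of `P(D)` corresponding to the ray `ρ`. -/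
def polytopeEdge {R : Set (ℤ × ℤ)} (D : RDivisor R) (ρ : R) : Set (ℝ × ℝ) :=
  {x | x ∈ polytope D ∧ dotR (toR ρ) x = -D ρ}

/-- The lattice length of a segment `F` on a line orthogonal to the primitive vector `u`: the
largest multiple of the primitive lattice vector `perp u` of that line that joins two points
of `F`. The length of the empty set is `0`. -/
noncomputable def latticeLength (u : ℤ × ℤ) (F : Set (ℝ × ℝ)) : ℝ :=
  sSup {t : ℝ | ∃ p ∈ F, ∃ q ∈ F, q - p = t • perp (toR u)}

/-- The divisor `D_Λ = ∑ ℓ_Λ(v) D_v` on the toric surface with ray generators `R`. -/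
noncomputable def polygonDivisor (R : Set (ℤ × ℤ)) (Λ : Set (ℝ × ℝ)) : RDivisor R :=
  fun v => omegaLength Λ (toR v)

/-! # Local intersection numbers -/

/-! Write `a_ρ` for the coefficients of `D`. Each maximal cone `(u, v)` has a vertex: the point `m`
with `⟨u, m⟩ = -a_u` and `⟨v, m⟩ = -a_v`, which need not lie in `P(D)`. Two boundary curves spanning
a cone meet with multiplicity `1 / |det|` (`localIntersection_eq`). This makes `D · D_ρ` explicit
and identifies it with the signed lattice distance between the vertices of the two cones that share
`ρ` (`vertex_sub_vertex`).

For (1), `D` is nef as soon as all `D · D_ρ` are nonnegative, since every other curve is linearly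
equivalent to an effective sum of boundary curves (`isNef_iff`). In that case `⟨w, m⟩` does not
increase as the cone turns towards `w` within a halfplane, and it ends at `-a_w`; so all vertices
lie in `P(D)` (`vertex_mem_polytope`), and the edge of `ρ` has length at least `D · D_ρ`. The
inequalities of the two neighbours of `ρ` bound that length from above
(`le_intersection_of_mem_polytopeEdge`). Conversely, lattice lengths are never negative.

For (2), no edge of `Λ` points strictly into a cone of the fan of slopes, so the two rays of a cone
have a common support point `p` in `Λ` (`exists_common_isSupportPoint_of_isMaximalCone`). Rotated by
`perp`, it is the vertex of `D_Λ` at that cone. This gives nefness and, by separation, the polytope.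
Nef divisors have nonempty edges, so the polytope determines the coefficients. By (1) the edge of
`Λ` along a slope `v` is `(D_Λ · D_v) v`, and the perimeter formula is `D_Λ · D_Ω = ∑ ℓ_Ω(v) (D_Λ ·
D_v)` with `ℓ_Ω` positively homogeneous. -/

theorem crossZ_swap (u v : ℤ × ℤ) : crossZ u v = -crossZ v u := by
  simp only [crossZ]; ring

theorem crossZ_self (u : ℤ × ℤ) : crossZ u u = 0 := by
  simp only [crossZ]; ring

theorem eq_zero_of_pairing_eq_zero {u v m : ℤ × ℤ} (h : crossZ u v ≠ 0)
    (hu : pairing m u = 0) (hv : pairing m v = 0) : m = 0 := by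
  simp only [crossZ, pairing] at h hu hv
  have h1 : m.1 * (u.1 * v.2 - u.2 * v.1) = 0 := by linear_combination v.2 * hu - u.2 * hv
  have h2 : m.2 * (u.1 * v.2 - u.2 * v.1) = 0 := by linear_combination u.1 * hv - v.1 * hu
  exact Prod.ext ((mul_eq_zero.1 h1).resolve_right h) ((mul_eq_zero.1 h2).resolve_right h)

/-- The dual cone is pointed because `u` and `v` are independent. This makes evaluation at the fixed
point multiplicative. -/
theorem dualMonoid_add_eq_zero {u v : ℤ × ℤ} (h : crossZ u v ≠ 0) {m n : dualMonoid u v} :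
    m + n = 0 ↔ m = 0 ∧ n = 0 := by
  refine ⟨fun hmn => ?_, by rintro ⟨rfl, rfl⟩; simp⟩
  obtain ⟨m, hm1, hm2⟩ := m
  obtain ⟨n, hn1, hn2⟩ := n
  have hmn' : m + n = 0 := congrArg Subtype.val hmn
  have h1 : pairing m u + pairing n u = 0 := by
    have : pairing (m + n) u = 0 := by rw [hmn']; simp [pairing]
    simp only [pairing, Prod.fst_add, Prod.snd_add] at this ⊢
    linarith
  have h2 : pairing m v + pairing n v = 0 := by
    have : pairing (m + n) v = 0 := by rw [hmn']; simp [pairing]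
    simp only [pairing, Prod.fst_add, Prod.snd_add] at this ⊢
    linarith
  have hm : m = 0 := eq_zero_of_pairing_eq_zero h (by omega) (by omega)
  have hn : n = 0 := eq_zero_of_pairing_eq_zero h (by omega) (by omega)
  exact ⟨Subtype.ext hm, Subtype.ext hn⟩

open Classical in
/-- Evaluation of functions on the chart of a two-dimensional cone at the torus-fixed point. -/
noncomputable def evalFixedPoint {u v : ℤ × ℤ} (h : crossZ u v ≠ 0) : ChartRing u v →ₐ[ℂ] ℂ :=
  AddMonoidAlgebra.lift ℂ ℂ (dualMonoid u v)
    { toFun := fun m => if m.toAdd = 0 then 1 else 0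
      map_one' := by simp
      map_mul' := fun m n => by
        have := dualMonoid_add_eq_zero h (m := m.toAdd) (n := n.toAdd)
        by_cases hm : m.toAdd = 0 <;> by_cases hn : n.toAdd = 0 <;> simp_all }

open Classical in
theorem evalFixedPoint_single {u v : ℤ × ℤ} (h : crossZ u v ≠ 0) (m : dualMonoid u v) (a : ℂ) :
    evalFixedPoint h (AddMonoidAlgebra.single m a) = if m = 0 then a else 0 := by
  simp [evalFixedPoint, AddMonoidAlgebra.lift_single]

theorem exists_eq_mul_of_pairing_eq_zero {v m : ℤ × ℤ} (hv : IsCoprime v.1 v.2)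
    (h : pairing m v = 0) : ∃ k : ℤ, m = (-(k * v.2), k * v.1) := by
  obtain ⟨a, b, hab⟩ := hv
  simp only [pairing] at h
  refine ⟨a * m.2 - b * m.1, Prod.ext ?_ ?_⟩
  · simp only; linear_combination (-m.1) * hab + a * h
  · simp only; linear_combination (-m.2) * hab + b * h

/-- If `⟨m, v⟩ > 0`, the character vanishes on `D_v`. Otherwise `m` is on the ray orthogonal to `v`,
whose primitive generator pairs with `u` to `|det|`, so `χ^m` is a multiple of the generator of
`multipleIdeal`. -/
theorem chi_mem_of_ne_zero {u v : ℤ × ℤ} (h : crossZ u v ≠ 0) (hv : IsCoprime v.1 v.2)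
    {m : dualMonoid u v} (hm : m ≠ 0) : chi m ∈ multipleIdeal u v ⊔ boundaryIdeal u v := by
  rcases lt_or_eq_of_le m.2.2 with hmv | hmv
  · exact Ideal.mem_sup_right (Ideal.subset_span ⟨m, hmv, rfl⟩)
  apply Ideal.mem_sup_left
  obtain ⟨k, hk⟩ := exists_eq_mul_of_pairing_eq_zero hv hmv.symm
  -- `s` is minus the sign of the determinant; it turns `s • (-v.2, v.1)` to the side where the
  -- pairing with `u` is positive.
  obtain ⟨s, hs, hs'⟩ : ∃ s : ℤ, s * s = 1 ∧ |crossZ u v| = -(s * crossZ u v) := by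
    rcases abs_choice (crossZ u v) with h' | h'
    · exact ⟨-1, by norm_num, by rw [h']; ring⟩
    · exact ⟨1, by norm_num, by rw [h']; ring⟩
  have hc : 0 < |crossZ u v| := abs_pos.2 h
  have hmu : pairing m u = s * k * |crossZ u v| := by
    rw [hk, hs']
    simp only [pairing, crossZ]
    linear_combination (k * (u.1 * v.2 - u.2 * v.1)) * hs
  have hk1 : 1 ≤ s * k := by
    have h0 : 0 ≤ s * k * |crossZ u v| := hmu ▸ m.2.1
    have h1 : 0 ≤ s * k := nonneg_of_mul_nonneg_left h0 hc
    rcases h1.lt_or_eq with h2 | h2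
    · omega
    · exact absurd (Subtype.ext (eq_zero_of_pairing_eq_zero h (by rw [hmu, ← h2, zero_mul])
        hmv.symm)) hm
  have e1 : pairing (-(s * v.2), s * v.1) u = |crossZ u v| := by
    rw [hs']; simp only [pairing, crossZ]; ring
  have e2 : pairing (-(s * v.2), s * v.1) v = 0 := by simp only [pairing]; ring
  let g : dualMonoid u v := ⟨(-(s * v.2), s * v.1), by rw [e1]; positivity, e2.ge⟩
  have e3 : pairing ((m : ℤ × ℤ) - (-(s * v.2), s * v.1)) u = (s * k - 1) * |crossZ u v| := by
    have : pairing ((m : ℤ × ℤ) - (-(s * v.2), s * v.1)) u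
        = pairing m u - pairing (-(s * v.2), s * v.1) u := by
      simp only [pairing, Prod.fst_sub, Prod.snd_sub]; ring
    rw [this, hmu, e1]; ring
  have e4 : pairing ((m : ℤ × ℤ) - (-(s * v.2), s * v.1)) v = 0 := by
    have : pairing ((m : ℤ × ℤ) - (-(s * v.2), s * v.1)) v
        = pairing m v - pairing (-(s * v.2), s * v.1) v := by
      simp only [pairing, Prod.fst_sub, Prod.snd_sub]; ring
    rw [this, ← hmv, e2]; ring
  let r : dualMonoid u v := ⟨(m : ℤ × ℤ) - (-(s * v.2), s * v.1),
    by rw [e3]; exact mul_nonneg (by omega) hc.le, e4.ge⟩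
  have hsum : m = r + g := Subtype.ext (sub_add_cancel _ _).symm
  have : chi m = chi r * chi g := by
    rw [hsum]; simp [chi, AddMonoidAlgebra.single_mul_single]
  rw [this]
  exact Ideal.mul_mem_left _ _ (Ideal.subset_span ⟨g, e1, e2, rfl⟩)

/-- Modulo the ideal all characters but `χ^0` vanish, so a function is congruent to its value at the
fixed point; the quotient is `ℂ`. -/
theorem ker_evalFixedPoint {u v : ℤ × ℤ} (h : crossZ u v ≠ 0) (hv : IsCoprime v.1 v.2) :
    multipleIdeal u v ⊔ boundaryIdeal u v = RingHom.ker (evalFixedPoint h) := by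
  classical
  apply le_antisymm
  · refine sup_le (Ideal.span_le.2 ?_) (Ideal.span_le.2 ?_)
    · rintro _ ⟨m, hm, -, rfl⟩
      have : m ≠ 0 := by
        rintro rfl
        refine (abs_pos.2 h).ne ?_
        simpa [pairing] using hm
      simp [chi, RingHom.mem_ker, evalFixedPoint_single, this]
    · rintro _ ⟨m, hm, rfl⟩
      have : m ≠ 0 := by
        rintro rfl
        simp [pairing] at hm
      simp [chi, RingHom.mem_ker, evalFixedPoint_single, this]
  · have key : ∀ f : ChartRing u v, f - AddMonoidAlgebra.single 0 (evalFixedPoint h f) ∈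
        multipleIdeal u v ⊔ boundaryIdeal u v := by
      intro f
      induction f using AddMonoidAlgebra.induction_linear with
      | zero => simp
      | add f g hf hg =>
        have := Ideal.add_mem _ hf hg
        rw [map_add, AddMonoidAlgebra.single_add]
        convert this using 1
        ring
      | single m a =>
        rw [evalFixedPoint_single]
        split_ifs with hm
        · simp [hm]
        · have h1 := Ideal.mul_mem_left _ (AddMonoidAlgebra.single 0 a)
            (chi_mem_of_ne_zero h hv hm)
          simpa [chi, AddMonoidAlgebra.single_mul_single] using h1
    intro f hf
    have := key f
    rw [RingHom.mem_ker] at hf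
    simpa [hf] using this

theorem localIntersection_eq {u v : ℤ × ℤ} (h : crossZ u v ≠ 0) (hv : IsCoprime v.1 v.2) :
    localIntersection u v = 1 / (|crossZ u v| : ℤ) := by
  have hsurj : Function.Surjective (evalFixedPoint h) := fun a =>
    ⟨AddMonoidAlgebra.single 0 a, by classical simp [evalFixedPoint_single]⟩
  have : Module.finrank ℂ (ChartRing u v ⧸ (multipleIdeal u v ⊔ boundaryIdeal u v)) = 1 := by
    rw [ker_evalFixedPoint h hv,
      (Ideal.quotientKerAlgEquivOfSurjective hsurj).toLinearEquiv.finrank_eq,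
      Module.finrank_self]
  rw [localIntersection, this, Nat.cast_one]

/-! # Rays of a complete fan -/

theorem cross_swap (p q : ℝ × ℝ) : cross p q = -cross q p := by
  simp only [cross]; ring

theorem cross_toR (u v : ℤ × ℤ) : cross (toR u) (toR v) = (crossZ u v : ℝ) := by
  simp [cross, toR, crossZ]

theorem cross_comb_right (x p q : ℝ × ℝ) (a b : ℝ) :
    cross x (a • p + b • q) = a * cross x p + b * cross x q := by
  simp only [cross, Prod.fst_add, Prod.snd_add, Prod.smul_fst, Prod.smul_snd, smul_eq_mul]
  ring

theorem cross_comb_left (x p q : ℝ × ℝ) (a b : ℝ) :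
    cross (a • p + b • q) x = a * cross p x + b * cross q x := by
  simp only [cross, Prod.fst_add, Prod.snd_add, Prod.smul_fst, Prod.smul_snd, smul_eq_mul]
  ring

theorem cross_sub_right (x p q : ℝ × ℝ) : cross x (p - q) = cross x p - cross x q := by
  simp only [cross, Prod.fst_sub, Prod.snd_sub]; ring

theorem cross_smul_left (a : ℝ) (x p : ℝ × ℝ) : cross (a • x) p = a * cross x p := by
  simp only [cross, Prod.smul_fst, Prod.smul_snd, smul_eq_mul]; ring

theorem cross_smul_right (a : ℝ) (x p : ℝ × ℝ) : cross x (a • p) = a * cross x p := by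
  simp only [cross, Prod.smul_fst, Prod.smul_snd, smul_eq_mul]; ring

theorem cross_self_eq_zero (x : ℝ × ℝ) : cross x x = 0 := by
  simp only [cross]; ring

theorem cross_neg_left (x p : ℝ × ℝ) : cross (-x) p = -cross x p := by
  simp only [cross, Prod.fst_neg, Prod.snd_neg]; ring

theorem normSq_pos {x : ℝ × ℝ} (hx : x ≠ 0) : 0 < x.1 * x.1 + x.2 * x.2 := by
  by_contra! h
  have h1 : x.1 = 0 := by nlinarith [mul_self_nonneg x.1, mul_self_nonneg x.2]
  have h2 : x.2 = 0 := by nlinarith [mul_self_nonneg x.1, mul_self_nonneg x.2]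
  exact hx (Prod.ext h1 h2)

theorem cross_perp (x : ℝ × ℝ) : cross x (perp x) = x.1 * x.1 + x.2 * x.2 := by
  simp only [cross, perp]; ring

theorem toR_ne_zero {u : ℤ × ℤ} (hu : IsCoprime u.1 u.2) : toR u ≠ 0 := by
  intro h
  have h1 : (u.1 : ℝ) = 0 := congrArg Prod.fst h
  have h2 : (u.2 : ℝ) = 0 := congrArg Prod.snd h
  obtain ⟨a, b, hab⟩ := hu
  rw [Int.cast_eq_zero.1 h1, Int.cast_eq_zero.1 h2] at hab
  simp at hab

theorem eq_or_eq_neg_of_crossZ_eq_zero {u v : ℤ × ℤ} (hu : IsCoprime u.1 u.2)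
    (hv : IsCoprime v.1 v.2) (h : crossZ u v = 0) : u = v ∨ u = -v := by
  obtain ⟨a, b, hab⟩ := hv
  simp only [crossZ] at h
  have h1 : u.1 = (a * u.1 + b * u.2) * v.1 := by linear_combination (-u.1) * hab + b * h
  have h2 : u.2 = (a * u.1 + b * u.2) * v.2 := by linear_combination (-u.2) * hab - a * h
  have hk : IsUnit (a * u.1 + b * u.2) :=
    hu.isUnit_of_dvd' ⟨v.1, h1⟩ ⟨v.2, h2⟩
  rcases Int.isUnit_iff.1 hk with hk | hk
  · left; exact Prod.ext (by rw [h1, hk, one_mul]) (by rw [h2, hk, one_mul])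
  · right; exact Prod.ext (by rw [h1, hk]; simp) (by rw [h2, hk]; simp)

theorem eq_of_toR_eq_smul {u v : ℤ × ℤ} (hu : IsCoprime u.1 u.2) (hv : IsCoprime v.1 v.2)
    {r : ℝ} (hr : 0 ≤ r) (h : toR u = r • toR v) : u = v := by
  have hc : crossZ u v = 0 := by
    have : (crossZ u v : ℝ) = 0 := by
      rw [← cross_toR, h, cross_smul_left, cross_self_eq_zero, mul_zero]
    exact_mod_cast this
  rcases eq_or_eq_neg_of_crossZ_eq_zero hu hv hc with rfl | rfl
  · rfl
  exfalso
  have hneg : toR (-v) = -toR v := by ext <;> simp [toR]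
  rw [hneg] at h
  have : (r + 1) • toR v = 0 := by rw [add_smul, ← h]; simp
  rcases smul_eq_zero.1 this with h' | h'
  · linarith
  · exact toR_ne_zero hv h'

theorem mem_cone_of_cross_nonneg {u v : ℤ × ℤ} {x : ℝ × ℝ} (h : 0 < crossZ u v)
    (h1 : 0 ≤ cross (toR u) x) (h2 : 0 ≤ cross x (toR v)) : x ∈ cone u v := by
  have hc : 0 < cross (toR u) (toR v) := by rw [cross_toR]; exact_mod_cast h
  refine ⟨cross x (toR v) / cross (toR u) (toR v), cross (toR u) x / cross (toR u) (toR v),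
    by positivity, by positivity, ?_⟩
  have hc' := hc.ne'
  apply Prod.ext <;> simp only [Prod.fst_add, Prod.snd_add, Prod.smul_fst, Prod.smul_snd,
    smul_eq_mul] <;> field_simp <;> simp only [cross] <;> ring

theorem exists_nearest_left {R : Set (ℤ × ℤ)} (hfin : R.Finite) {x : ℝ × ℝ} (hx : x ≠ 0)
    (h : ∃ w ∈ R, 0 < cross x (toR w)) :
    ∃ v ∈ R, 0 < cross x (toR v) ∧ ∀ w ∈ R, 0 < cross x (toR w) → 0 ≤ cross (toR v) (toR w) := by
  obtain ⟨w₀, hw₀⟩ := h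
  -- The smallest angle from `x` has the largest cotangent `dotR / cross`. The conclusion then
  -- follows from `|x|² (v × w) = (x · v)(x × w) - (x × v)(x · w)`.
  obtain ⟨v, ⟨hv, hxv⟩, hmax⟩ := Set.exists_max_image {w | w ∈ R ∧ 0 < cross x (toR w)}
    (fun w => dotR x (toR w) / cross x (toR w)) (hfin.subset fun _ h => h.1) ⟨w₀, hw₀⟩
  refine ⟨v, hv, hxv, fun w hw hxw => ?_⟩
  have := hmax w ⟨hw, hxw⟩
  rw [div_le_div_iff₀ hxw hxv] at this
  refine nonneg_of_mul_nonneg_right (a := x.1 * x.1 + x.2 * x.2) ?_ (normSq_pos hx)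
  simp only [cross, dotR] at this ⊢
  nlinarith

theorem exists_nearest_right {R : Set (ℤ × ℤ)} (hfin : R.Finite) {x : ℝ × ℝ} (hx : x ≠ 0)
    (h : ∃ w ∈ R, 0 < cross (toR w) x) :
    ∃ v ∈ R, 0 < cross (toR v) x ∧ ∀ w ∈ R, 0 < cross (toR w) x → 0 ≤ cross (toR w) (toR v) := by
  obtain ⟨w₀, hw₀⟩ := h
  obtain ⟨v, ⟨hv, hxv⟩, hmax⟩ := Set.exists_max_image {w | w ∈ R ∧ 0 < cross (toR w) x}
    (fun w => dotR x (toR w) / cross (toR w) x) (hfin.subset fun _ h => h.1) ⟨w₀, hw₀⟩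
  refine ⟨v, hv, hxv, fun w hw hxw => ?_⟩
  have := hmax w ⟨hw, hxw⟩
  rw [div_le_div_iff₀ hxw hxv] at this
  refine nonneg_of_mul_nonneg_right (a := x.1 * x.1 + x.2 * x.2) ?_ (normSq_pos hx)
  simp only [cross, dotR] at this ⊢
  nlinarith

theorem exists_isMaximalCone_right {R : Set (ℤ × ℤ)} (hfin : R.Finite)
    (hprim : ∀ u ∈ R, IsCoprime u.1 u.2) {u : ℤ × ℤ} (hu : u ∈ R)
    (h : ∃ w ∈ R, 0 < cross (toR u) (toR w)) : ∃ v, IsMaximalCone R u v := by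
  obtain ⟨v, hv, huv, hmin⟩ := exists_nearest_left hfin (toR_ne_zero (hprim u hu)) h
  refine ⟨v, hu, hv, by rw [cross_toR] at huv; exact_mod_cast huv, ?_⟩
  rintro w hw ⟨a, b, ha, hb, hab⟩
  rcases hb.eq_or_lt with rfl | hb
  · left
    exact eq_of_toR_eq_smul (hprim w hw) (hprim u hu) ha (by simpa using hab)
  right
  have h1 : cross (toR u) (toR w) = b * cross (toR u) (toR v) := by
    rw [hab, cross_comb_right, cross_self_eq_zero]; ring
  have h2 : cross (toR v) (toR w) = -(a * cross (toR u) (toR v)) := by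
    rw [hab, cross_comb_right, cross_self_eq_zero, cross_swap (toR v)]; ring
  have h3 := hmin w hw (by rw [h1]; positivity)
  have ha0 : a = 0 := by
    by_contra hne
    have := mul_pos (lt_of_le_of_ne ha (Ne.symm hne)) huv
    linarith
  exact eq_of_toR_eq_smul (hprim w hw) (hprim v hv) hb.le (by simpa [ha0] using hab)

theorem exists_isMaximalCone_left {R : Set (ℤ × ℤ)} (hfin : R.Finite)
    (hprim : ∀ u ∈ R, IsCoprime u.1 u.2) {u : ℤ × ℤ} (hu : u ∈ R)
    (h : ∃ w ∈ R, 0 < cross (toR w) (toR u)) : ∃ v, IsMaximalCone R v u := by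
  obtain ⟨v, hv, huv, hmin⟩ := exists_nearest_right hfin (toR_ne_zero (hprim u hu)) h
  refine ⟨v, hv, hu, by rw [cross_toR] at huv; exact_mod_cast huv, ?_⟩
  rintro w hw ⟨a, b, ha, hb, hab⟩
  rcases ha.eq_or_lt with rfl | ha
  · right
    exact eq_of_toR_eq_smul (hprim w hw) (hprim u hu) hb (by simpa using hab)
  left
  have h1 : cross (toR w) (toR u) = a * cross (toR v) (toR u) := by
    rw [hab, cross_comb_left, cross_self_eq_zero]; ring
  have h2 : cross (toR w) (toR v) = -(b * cross (toR v) (toR u)) := by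
    rw [hab, cross_comb_left, cross_self_eq_zero, cross_swap (toR u)]; ring
  have h3 := hmin w hw (by rw [h1]; positivity)
  have hb0 : b = 0 := by
    by_contra hne
    have := mul_pos (lt_of_le_of_ne hb (Ne.symm hne)) huv
    linarith
  exact eq_of_toR_eq_smul (hprim w hw) (hprim v hv) ha.le (by simpa [hb0] using hab)

/-- A finite set of primitive vectors that is not contained in a closed halfplane generates a
complete fan. -/
theorem isCompleteFan_of_forall_exists_cross_pos {R : Set (ℤ × ℤ)} (hfin : R.Finite)
    (hprim : ∀ u ∈ R, IsCoprime u.1 u.2)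
    (hspan : ∀ x : ℝ × ℝ, x ≠ 0 → ∃ w ∈ R, 0 < cross x (toR w)) : IsCompleteFan R := by
  refine ⟨hfin, hprim, fun x => ?_⟩
  rcases eq_or_ne x 0 with rfl | hx
  · obtain ⟨u, hu, -⟩ := hspan (1, 0) (by simp)
    obtain ⟨v, huv⟩ := exists_isMaximalCone_right hfin hprim hu
      (hspan _ (toR_ne_zero (hprim u hu)))
    exact ⟨u, v, huv, 0, 0, le_rfl, le_rfl, by simp⟩
  -- `v` is the first ray anticlockwise from `x` and `u` the ray before `v`. If `x` were not to the
  -- left of `u`, then `u` would be nearer to `x` than `v`.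
  · obtain ⟨v, hv, hxv, hmin⟩ := exists_nearest_left hfin hx (hspan x hx)
    obtain ⟨w, hw, hwv⟩ := hspan (-toR v) (neg_ne_zero.2 (toR_ne_zero (hprim v hv)))
    rw [cross_neg_left, ← cross_swap] at hwv
    obtain ⟨u, huv⟩ := exists_isMaximalCone_left hfin hprim hv ⟨w, hw, hwv⟩
    refine ⟨u, v, huv, mem_cone_of_cross_nonneg huv.2.2.1 ?_ hxv.le⟩
    by_contra! hux
    have h1 := hmin u huv.1 (by rw [cross_swap]; linarith)
    have h2 : 0 < cross (toR u) (toR v) := by rw [cross_toR]; exact_mod_cast huv.2.2.1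
    rw [cross_swap] at h1
    linarith

namespace IsCompleteFan

variable {R : Set (ℤ × ℤ)}

/-- The vector `perp x` lies in some cone and `x × perp x = |x|² > 0`, so a generator of that cone
has positive cross product with `x`. -/
theorem exists_cross_pos (hR : IsCompleteFan R) {x : ℝ × ℝ} (hx : x ≠ 0) :
    ∃ w ∈ R, 0 < cross x (toR w) := by
  obtain ⟨u, v, huv, a, b, ha, hb, hab⟩ := hR.complete (perp x)
  have h := normSq_pos hx
  rw [← cross_perp, hab, cross_comb_right] at h
  by_contra! hcon
  have h1 := mul_nonpos_of_nonneg_of_nonpos ha (hcon u huv.1)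
  have h2 := mul_nonpos_of_nonneg_of_nonpos hb (hcon v huv.2.1)
  linarith

theorem exists_next (hR : IsCompleteFan R) (ρ : R) : ∃ ν : R, IsMaximalCone R ρ ν := by
  obtain ⟨v, hv⟩ := exists_isMaximalCone_right hR.finite hR.primitive ρ.2
    (hR.exists_cross_pos (toR_ne_zero (hR.primitive _ ρ.2)))
  exact ⟨⟨v, hv.2.1⟩, hv⟩

theorem exists_prev (hR : IsCompleteFan R) (ρ : R) : ∃ π : R, IsMaximalCone R π ρ := by
  obtain ⟨w, hw, h⟩ := hR.exists_cross_pos (neg_ne_zero.2 (toR_ne_zero (hR.primitive _ ρ.2)))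
  rw [cross_neg_left, ← cross_swap] at h
  obtain ⟨v, hv⟩ := exists_isMaximalCone_left hR.finite hR.primitive ρ.2 ⟨w, hw, h⟩
  exact ⟨⟨v, hv.1⟩, hv⟩

end IsCompleteFan

theorem IsMaximalCone.eq_or_eq_of_crossZ_nonneg {R : Set (ℤ × ℤ)} {u v w : ℤ × ℤ}
    (h : IsMaximalCone R u v) (hw : w ∈ R) (h1 : 0 ≤ crossZ u w) (h2 : 0 ≤ crossZ w v) :
    w = u ∨ w = v :=
  h.2.2.2 w hw (mem_cone_of_cross_nonneg h.2.2.1 (by rw [cross_toR]; exact_mod_cast h1)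
    (by rw [cross_toR]; exact_mod_cast h2))

/-- Of two candidates, the one nearer to `u` would lie in the cone of the other. -/
theorem IsMaximalCone.right_unique {R : Set (ℤ × ℤ)} {u v w : ℤ × ℤ}
    (hv : IsMaximalCone R u v) (hw : IsMaximalCone R u w) : v = w := by
  rcases le_total 0 (crossZ v w) with h | h
  · refine (hw.eq_or_eq_of_crossZ_nonneg hv.2.1 hv.2.2.1.le h).resolve_left ?_
    rintro rfl
    exact hv.2.2.1.ne' (crossZ_self _)
  · refine ((hv.eq_or_eq_of_crossZ_nonneg hw.2.1 hw.2.2.1.le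
      (by rw [crossZ_swap]; omega)).resolve_left ?_).symm
    rintro rfl
    exact hw.2.2.1.ne' (crossZ_self _)

theorem IsMaximalCone.left_unique {R : Set (ℤ × ℤ)} {u v w : ℤ × ℤ}
    (hv : IsMaximalCone R v u) (hw : IsMaximalCone R w u) : v = w := by
  rcases le_total 0 (crossZ v w) with h | h
  · refine ((hv.eq_or_eq_of_crossZ_nonneg hw.1 h hw.2.2.1.le).resolve_right ?_).symm
    rintro rfl
    exact hw.2.2.1.ne' (crossZ_self _)
  · refine (hw.eq_or_eq_of_crossZ_nonneg hv.1 (by rw [crossZ_swap]; omega)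
      hv.2.2.1.le).resolve_right ?_
    rintro rfl
    exact hv.2.2.1.ne' (crossZ_self _)

/-! # Intersection numbers on a toric surface -/

theorem dotR_toR (m u : ℤ × ℤ) : dotR (toR u) (toR m) = (pairing m u : ℝ) := by
  simp [dotR, toR, pairing]; ring

theorem pairing_bezout {u : ℤ × ℤ} (hu : IsCoprime u.1 u.2) : pairing (bezout u) u = 1 := by
  have h := Int.gcd_eq_gcd_ab u.1 u.2
  rw [Int.isCoprime_iff_gcd_eq_one.1 hu] at h
  simp only [pairing, bezout]
  push_cast at h
  linarith

theorem properIntersection_comm {R : Set (ℤ × ℤ)} (hR : IsCompleteFan R) (ρ τ : R) :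
    properIntersection ρ τ = properIntersection τ ρ := by
  unfold properIntersection
  by_cases h : IsMaximalCone R ρ τ ∨ IsMaximalCone R τ ρ
  · have hc : crossZ ρ τ ≠ 0 := by
      rcases h with h | h
      · exact h.2.2.1.ne'
      · rw [crossZ_swap]; exact neg_ne_zero.2 h.2.2.1.ne'
    rw [if_pos h, if_pos h.symm, localIntersection_eq hc (hR.primitive _ τ.2),
      localIntersection_eq (by rw [crossZ_swap]; exact neg_ne_zero.2 hc) (hR.primitive _ ρ.2),
      crossZ_swap, abs_neg]
  · rw [if_neg h, if_neg (fun h' => h h'.symm)]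

theorem boundaryIntersection_comm {R : Set (ℤ × ℤ)} (hR : IsCompleteFan R) (ρ τ : R) :
    boundaryIntersection ρ τ = boundaryIntersection τ ρ := by
  unfold boundaryIntersection
  by_cases h : ρ = τ
  · subst h; rfl
  · rw [if_neg h, if_neg (Ne.symm h), properIntersection_comm hR]

theorem properIntersection_self {R : Set (ℤ × ℤ)} (ρ : R) : properIntersection ρ ρ = 0 := by
  unfold properIntersection
  refine if_neg ?_
  rintro (h | h) <;> exact h.2.2.1.ne' (crossZ_self _)

/-- Only the two neighbours of `ρ` meet `D_ρ`; they are distinct since they lie on opposite sides of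
`ρ`. -/
theorem sum_mul_properIntersection {R : Set (ℤ × ℤ)} [Fintype R] (hR : IsCompleteFan R)
    {π ρ ν : R} (hπ : IsMaximalCone R π ρ) (hν : IsMaximalCone R ρ ν) (D : RDivisor R) :
    ∑ κ, D κ * properIntersection κ ρ = D π / crossZ π ρ + D ν / crossZ ρ ν := by
  classical
  have hne : π ≠ ν := by
    rintro rfl
    have h1 := hπ.2.2.1
    have h2 := hν.2.2.1
    rw [crossZ_swap] at h2
    omega
  rw [← Finset.sum_subset (Finset.subset_univ {π, ν}), Finset.sum_pair hne]
  · have e1 : properIntersection π ρ = 1 / crossZ π ρ := by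
      unfold properIntersection
      rw [if_pos (Or.inl hπ), localIntersection_eq hπ.2.2.1.ne' (hR.primitive _ ρ.2),
        abs_of_pos hπ.2.2.1]
    have e2 : properIntersection ν ρ = 1 / crossZ ρ ν := by
      rw [properIntersection_comm hR]
      unfold properIntersection
      rw [if_pos (Or.inl hν), localIntersection_eq hν.2.2.1.ne' (hR.primitive _ ν.2),
        abs_of_pos hν.2.2.1]
    rw [e1, e2, mul_one_div, mul_one_div]
  · intro κ _ hκ
    simp only [Finset.mem_insert, Finset.mem_singleton, not_or] at hκ
    have : properIntersection κ ρ = 0 := by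
      unfold properIntersection
      refine if_neg ?_
      rintro (h | h)
      · exact hκ.1 (Subtype.ext (h.left_unique hπ))
      · exact hκ.2 (Subtype.ext (h.right_unique hν))
    rw [this, mul_zero]

theorem intersection_eq_sum {R : Set (ℤ × ℤ)} [Fintype R] (D E : RDivisor R) :
    intersection D E = ∑ ρ, ∑ τ, D ρ * E τ * boundaryIntersection ρ τ := by
  simp only [intersection, finsum_eq_sum_of_fintype]

theorem intersection_boundaryDivisor {R : Set (ℤ × ℤ)} [Fintype R] (D : RDivisor R) (ρ : R) :
    intersection D (boundaryDivisor ρ) = ∑ κ, D κ * boundaryIntersection κ ρ := by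
  classical
  rw [intersection_eq_sum]
  refine Finset.sum_congr rfl fun κ _ => ?_
  rw [Finset.sum_eq_single ρ]
  · simp [boundaryDivisor]
  · intro τ _ hτ
    simp [boundaryDivisor, hτ]
  · simp

theorem intersection_eq_sum_boundaryDivisor {R : Set (ℤ × ℤ)} [Fintype R] (D E : RDivisor R) :
    intersection D E = ∑ τ, E τ * intersection D (boundaryDivisor τ) := by
  rw [intersection_eq_sum, Finset.sum_comm]
  refine Finset.sum_congr rfl fun τ _ => ?_
  rw [intersection_boundaryDivisor, Finset.mul_sum]
  exact Finset.sum_congr rfl fun κ _ => by ring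

theorem intersection_comm {R : Set (ℤ × ℤ)} (hR : IsCompleteFan R) (D E : RDivisor R) :
    intersection D E = intersection E D := by
  have := hR.finite.fintype
  rw [intersection_eq_sum, intersection_eq_sum, Finset.sum_comm]
  refine Finset.sum_congr rfl fun τ _ => Finset.sum_congr rfl fun ρ _ => ?_
  rw [boundaryIntersection_comm hR]; ring

theorem intersection_boundaryDivisor_eq {R : Set (ℤ × ℤ)} (hR : IsCompleteFan R) {π ρ ν : R}
    (hπ : IsMaximalCone R π ρ) (hν : IsMaximalCone R ρ ν) (D : RDivisor R) :
    intersection D (boundaryDivisor ρ) = D π / crossZ π ρ + D ν / crossZ ρ ν -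
      D ρ * (pairing (bezout ρ) π / crossZ π ρ + pairing (bezout ρ) ν / crossZ ρ ν) := by
  classical
  have := hR.finite.fintype
  have hself : boundaryIntersection ρ ρ =
      -(pairing (bezout ρ) π / crossZ π ρ + pairing (bezout ρ) ν / crossZ ρ ν : ℝ) := by
    rw [← sum_mul_properIntersection hR hπ hν fun κ => (pairing (bezout ρ) κ : ℝ)]
    unfold boundaryIntersection
    rw [if_pos rfl, ← finsum_eq_sum_of_fintype]
    -- The excluded index `κ = ρ` may be put back, as `properIntersection ρ ρ = 0`.
    congr 1
    refine finsum_congr fun κ => ?_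
    by_cases h : κ = ρ
    · subst h; simp [properIntersection_self]
    · simp [h]
  have hsum : intersection D (boundaryDivisor ρ) =
      ∑ κ, D κ * properIntersection κ ρ + D ρ * boundaryIntersection ρ ρ := by
    rw [intersection_boundaryDivisor, ← Finset.add_sum_erase _ _ (Finset.mem_univ ρ),
      ← Finset.add_sum_erase _ (fun κ => D κ * properIntersection κ ρ) (Finset.mem_univ ρ),
      properIntersection_self, mul_zero, zero_add, add_comm]
    congr 1
    refine Finset.sum_congr rfl fun κ hκ => ?_
    unfold boundaryIntersection
    rw [if_neg (Finset.ne_of_mem_erase hκ)]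
  rw [hsum, sum_mul_properIntersection hR hπ hν, hself]
  ring

/-! ### Vertices of a divisor at the maximal cones -/

theorem exists_vertex {u v : ℤ × ℤ} (h : 0 < crossZ u v) (a b : ℝ) :
    ∃ m : ℝ × ℝ, dotR (toR u) m = -a ∧ dotR (toR v) m = -b := by
  have hc : cross (toR u) (toR v) ≠ 0 := by
    rw [cross_toR]; exact_mod_cast h.ne'
  refine ⟨((b * (toR u).2 - a * (toR v).2) / cross (toR u) (toR v),
    (a * (toR v).1 - b * (toR u).1) / cross (toR u) (toR v)), ?_, ?_⟩ <;>
  · simp only [dotR]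
    field_simp
    simp only [cross]
    ring

/-- The vertices of the two maximal cones at the ray `ρ` differ by the intersection number with
`D_ρ`, measured along the line orthogonal to `ρ`. -/
theorem vertex_sub_vertex {R : Set (ℤ × ℤ)} (hR : IsCompleteFan R) {π ρ ν : R}
    (hπ : IsMaximalCone R π ρ) (hν : IsMaximalCone R ρ ν) (D : RDivisor R) {m m' : ℝ × ℝ}
    (h1 : dotR (toR π) m = -D π) (h2 : dotR (toR ρ) m = -D ρ)
    (h3 : dotR (toR ρ) m' = -D ρ) (h4 : dotR (toR ν) m' = -D ν) :
    m - m' = intersection D (boundaryDivisor ρ) • perp (toR ρ) := by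
  rw [intersection_boundaryDivisor_eq hR hπ hν]
  have hc : 0 < cross (toR π) (toR ρ) := by
    rw [cross_toR]; exact_mod_cast hπ.2.2.1
  have hc' : 0 < cross (toR ρ) (toR ν) := by
    rw [cross_toR]; exact_mod_cast hν.2.2.1
  have hb : dotR (toR ρ) (toR (bezout ρ)) = 1 := by
    rw [dotR_toR, pairing_bezout (hR.primitive _ ρ.2), Int.cast_one]
  rw [← cross_toR, ← cross_toR, ← dotR_toR, ← dotR_toR]
  rw [← neg_eq_iff_eq_neg] at h1 h2 h4
  rw [← h1, ← h2, ← h4]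
  rw [← h2, neg_neg] at h3
  generalize toR π = p at *
  generalize toR ρ = r at *
  generalize toR ν = n at *
  generalize toR (bezout ρ) = b at *
  obtain ⟨d, hd⟩ : ∃ d, d = m - m' := ⟨_, rfl⟩
  have hm' : m' = m - d := by rw [hd]; abel
  subst hm'
  have hrd : dotR r d = 0 := by
    simp only [dotR, Prod.fst_sub, Prod.snd_sub] at h3 ⊢
    linarith
  -- `d` is orthogonal to `r`, hence a multiple of `perp r`; the factor is `b × d` because `⟨r, b⟩ =
  -- 1`.
  have hs : d = cross b d • perp r := by
    simp only [dotR, cross, perp] at hrd hb ⊢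
    apply Prod.ext <;> simp only [Prod.smul_fst, Prod.smul_snd, smul_eq_mul]
    · linear_combination (-d.1) * hb + b.1 * hrd
    · linear_combination (-d.2) * hb + b.2 * hrd
  -- The vector `p / (p × r) + n / (r × n)` has zero cross product with `r`, so it is a multiple of
  -- `r`, with factor its pairing with `b`.
  have hX : dotR r m * (dotR p b / cross p r + dotR n b / cross r n) =
      dotR p m / cross p r + dotR n m / cross r n := by
    have hc1 := hc.ne'
    have hc2 := hc'.ne'
    field_simp
    simp only [dotR, cross] at hb ⊢
    linear_combination (((p.1 * m.1 + p.2 * m.2) * (r.1 * n.2 - r.2 * n.1) +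
      (n.1 * m.1 + n.2 * m.2) * (p.1 * r.2 - p.2 * r.1))) * hb
  have hn : dotR n d = cross b d * cross r n := by
    conv_lhs => rw [hs]
    simp only [dotR, cross, perp, Prod.smul_fst, Prod.smul_snd, smul_eq_mul]; ring
  have ht : -dotR p m / cross p r + -dotR n (m - d) / cross r n -
      -dotR r m * (dotR p b / cross p r + dotR n b / cross r n) = cross b d := by
    have e : dotR n (m - d) = dotR n m - cross b d * cross r n := by
      rw [← hn]; simp only [dotR, Prod.fst_sub, Prod.snd_sub]; ring
    rw [neg_mul, hX, e]
    field_simp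
    ring
  rw [ht, ← hs]
  abel

/-- For a principal divisor `-m` is the vertex at every cone, so adjacent vertices coincide and all
intersections with boundary curves vanish. -/
theorem intersection_principal {R : Set (ℤ × ℤ)} (hR : IsCompleteFan R) (D : RDivisor R)
    (m : ℤ × ℤ) : intersection D (fun κ => (pairing m κ : ℝ)) = 0 := by
  have := hR.finite.fintype
  rw [intersection_comm hR, intersection_eq_sum_boundaryDivisor]
  refine Finset.sum_eq_zero fun ρ _ => ?_
  obtain ⟨π, hπ⟩ := hR.exists_prev ρ
  obtain ⟨ν, hν⟩ := hR.exists_next ρ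
  have hdot : ∀ κ : R, dotR (toR κ) (-toR m) = -(pairing m κ : ℝ) := fun κ => by
    rw [← dotR_toR]; simp only [dotR, Prod.fst_neg, Prod.snd_neg]; ring
  have h := vertex_sub_vertex hR hπ hν (fun κ => (pairing m κ : ℝ)) (hdot π) (hdot ρ) (hdot ρ)
    (hdot ν)
  rw [sub_self] at h
  rcases smul_eq_zero.1 h.symm with h | h
  · rw [h, mul_zero]
  · have h0 := toR_ne_zero (hR.primitive _ ρ.2)
    simp only [perp, Prod.mk_eq_zero, neg_eq_zero] at h
    exact absurd (Prod.ext h.2 h.1) h0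

/-! ### Testing nefness on boundary curves -/

theorem ordAlong_le {f : AddMonoidAlgebra ℂ (ℤ × ℤ)} {m : ℤ × ℤ} (hm : f.coeff m ≠ 0)
    (u : ℤ × ℤ) : ordAlong u f ≤ pairing m u := by
  refine csInf_le (Set.Finite.bddBelow (Set.Finite.image _ ?_)) ⟨m, hm, rfl⟩
  exact f.coeff.hasFiniteSupport

/-- Adding the principal divisor of an exponent `m` of `f` to `closureDivisor R f` leaves the
intersection number unchanged and makes all coefficients `⟨m, ρ⟩ - ord_ρ f` nonnegative. -/
theorem isNef_iff {R : Set (ℤ × ℤ)} (hR : IsCompleteFan R) (D : RDivisor R) :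
    IsNef D ↔ ∀ ρ : R, 0 ≤ intersection D (boundaryDivisor ρ) := by
  refine ⟨fun h => h.1, fun h => ⟨h, fun f hf => ?_⟩⟩
  have := hR.finite.fintype
  obtain ⟨m, hm⟩ : ∃ m, f.coeff m ≠ 0 := by
    by_contra! hcon
    exact hf.ne_zero (AddMonoidAlgebra.ext (Finsupp.ext hcon))
  have h0 := intersection_principal hR D m
  rw [intersection_eq_sum_boundaryDivisor] at h0 ⊢
  have e : ∑ τ, closureDivisor R f τ * intersection D (boundaryDivisor τ) =
      ∑ τ : R, (closureDivisor R f τ * intersection D (boundaryDivisor τ) +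
        (pairing m τ : ℝ) * intersection D (boundaryDivisor τ)) := by
    rw [Finset.sum_add_distrib, h0, add_zero]
  rw [e]
  refine Finset.sum_nonneg fun ρ _ => ?_
  rw [← add_mul]
  refine mul_nonneg ?_ (h ρ)
  have : (ordAlong ρ f : ℝ) ≤ pairing m ρ := by exact_mod_cast ordAlong_le hm ρ
  simp only [closureDivisor]
  linarith

/-! # Nef divisors and their polytopes -/

theorem dotR_perp (w u : ℝ × ℝ) : dotR w (perp u) = cross u w := by
  simp only [dotR, perp, cross]; ring

theorem dotR_vertex {R : Set (ℤ × ℤ)} (hR : IsCompleteFan R) {π ρ ν : R}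
    (hπ : IsMaximalCone R π ρ) (hν : IsMaximalCone R ρ ν) (D : RDivisor R) {m m' : ℝ × ℝ}
    (h1 : dotR (toR π) m = -D π) (h2 : dotR (toR ρ) m = -D ρ)
    (h3 : dotR (toR ρ) m' = -D ρ) (h4 : dotR (toR ν) m' = -D ν) (w : ℤ × ℤ) :
    dotR (toR w) m =
      dotR (toR w) m' + intersection D (boundaryDivisor ρ) * crossZ ρ w := by
  have h := vertex_sub_vertex hR hπ hν D h1 h2 h3 h4
  have e : dotR (toR w) m = dotR (toR w) m' + dotR (toR w) (m - m') := by
    simp only [dotR, Prod.fst_sub, Prod.snd_sub]; ring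
  rw [e, h, ← cross_toR, ← dotR_perp]
  simp only [dotR, Prod.smul_fst, Prod.smul_snd, smul_eq_mul]; ring

/-! ### The vertices of a nef divisor lie in its polytope -/

theorem crossZ_pluecker (u v w z : ℤ × ℤ) :
    crossZ u z * crossZ v w = crossZ u v * crossZ z w + crossZ u w * crossZ v z := by
  simp only [crossZ]; ring

/-- The rays strictly between `u` and `w`, in anticlockwise order. -/
def raysBetween (R : Set (ℤ × ℤ)) (u w : ℤ × ℤ) : Set (ℤ × ℤ) :=
  {z | z ∈ R ∧ 0 < crossZ u z ∧ 0 < crossZ z w}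

/-- Termination measure for turning a cone towards `w`: the Plücker relation shows that rays between
`v` and `w` are also between `u` and `w`, and `v` itself is lost. -/
theorem raysBetween_ncard_lt_left {R : Set (ℤ × ℤ)} (hR : R.Finite) {u v w : ℤ × ℤ}
    (hv : v ∈ R) (huv : 0 < crossZ u v) (hvw : 0 < crossZ v w) (huw : 0 < crossZ u w) :
    (raysBetween R v w).ncard < (raysBetween R u w).ncard := by
  refine Set.ncard_lt_ncard ?_ (hR.subset fun z hz => hz.1)
  refine ⟨fun z hz => ⟨hz.1, ?_, hz.2.2⟩, fun h => ?_⟩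
  · have := crossZ_pluecker u v w z
    have h1 := mul_pos huv hz.2.2
    have h2 := mul_pos huw hz.2.1
    exact pos_of_mul_pos_left (by rw [this]; omega) hvw.le
  · have := (h ⟨hv, huv, hvw⟩ : v ∈ raysBetween R v w).2.1
    rw [crossZ_self] at this
    exact lt_irrefl _ this

theorem raysBetween_ncard_lt_right {R : Set (ℤ × ℤ)} (hR : R.Finite) {u v w : ℤ × ℤ}
    (hv : v ∈ R) (huv : 0 < crossZ u v) (hvw : 0 < crossZ v w) (huw : 0 < crossZ u w) :
    (raysBetween R u v).ncard < (raysBetween R u w).ncard := by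
  refine Set.ncard_lt_ncard ?_ (hR.subset fun z hz => hz.1)
  refine ⟨fun z hz => ⟨hz.1, hz.2.1, ?_⟩, fun h => ?_⟩
  · have := crossZ_pluecker u v w z
    have h1 := mul_pos hz.2.1 hvw
    have h2 := mul_pos huw hz.2.2
    rw [crossZ_swap v z, mul_neg] at this
    exact pos_of_mul_pos_right (a := crossZ u v) (by linarith) huv.le
  · have := (h ⟨hv, huv, hvw⟩ : v ∈ raysBetween R u v).2.2
    rw [crossZ_self] at this
    exact lt_irrefl _ this

section

variable {R : Set (ℤ × ℤ)} {D : RDivisor R}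

/-- Passing to the next cone anticlockwise changes `⟨w, m⟩` by `-(D · D_v)(v × w) ≤ 0`, and the walk
ends at a cone with ray `w`, where the value is `-D w`. -/
theorem le_dotR_vertex_of_crossZ_pos (hR : IsCompleteFan R)
    (hD : ∀ ρ : R, 0 ≤ intersection D (boundaryDivisor ρ)) {u v w : R} {m : ℝ × ℝ}
    (huv : IsMaximalCone R u v) (huw : 0 < crossZ u w)
    (h1 : dotR (toR u) m = -D u) (h2 : dotR (toR v) m = -D v) : -D w ≤ dotR (toR w) m := by
  induction hk : (raysBetween R u w).ncard using Nat.strong_induction_on generalizing u v m with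
  | _ k ih =>
    by_cases hvw : w = v
    · rw [hvw, h2]
    have hvw' : 0 < crossZ v w := by
      by_contra! hcon
      rcases huv.eq_or_eq_of_crossZ_nonneg w.2 huw.le (by rw [crossZ_swap]; omega) with h | h
      · rw [h, crossZ_self] at huw
        exact lt_irrefl _ huw
      · exact hvw (Subtype.ext h)
    obtain ⟨ν, hν⟩ := hR.exists_next v
    obtain ⟨m', h3, h4⟩ := exists_vertex hν.2.2.1 (D v) (D ν)
    rw [dotR_vertex hR huv hν D h1 h2 h3 h4 w]
    have h5 := ih _ (hk ▸ raysBetween_ncard_lt_left hR.finite v.2 huv.2.2.1 hvw' huw) hν hvw'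
      h3 h4 rfl
    have h6 : 0 ≤ intersection D (boundaryDivisor v) * crossZ v w :=
      mul_nonneg (hD v) (by exact_mod_cast hvw'.le)
    linarith

theorem le_dotR_vertex_of_crossZ_neg (hR : IsCompleteFan R)
    (hD : ∀ ρ : R, 0 ≤ intersection D (boundaryDivisor ρ)) {u v w : R} {m : ℝ × ℝ}
    (huv : IsMaximalCone R u v) (hwv : 0 < crossZ w v)
    (h1 : dotR (toR u) m = -D u) (h2 : dotR (toR v) m = -D v) : -D w ≤ dotR (toR w) m := by
  induction hk : (raysBetween R w v).ncard using Nat.strong_induction_on generalizing u v m with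
  | _ k ih =>
    by_cases huw : w = u
    · rw [huw, h1]
    have hwu : 0 < crossZ w u := by
      by_contra! hcon
      rcases huv.eq_or_eq_of_crossZ_nonneg w.2 (by rw [crossZ_swap]; omega) hwv.le with h | h
      · exact huw (Subtype.ext h)
      · rw [h, crossZ_self] at hwv
        exact lt_irrefl _ hwv
    obtain ⟨π, hπ⟩ := hR.exists_prev u
    obtain ⟨m', h3, h4⟩ := exists_vertex hπ.2.2.1 (D π) (D u)
    have h7 := dotR_vertex hR hπ huv D h3 h4 h1 h2 w
    have h5 := ih _ (hk ▸ raysBetween_ncard_lt_right hR.finite u.2 hwu huv.2.2.1 hwv) hπ hwu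
      h3 h4 rfl
    have h6 : 0 ≤ intersection D (boundaryDivisor u) * crossZ w u :=
      mul_nonneg (hD u) (by exact_mod_cast hwu.le)
    rw [crossZ_swap, Int.cast_neg] at h7
    linarith

theorem vertex_mem_polytope (hR : IsCompleteFan R)
    (hD : ∀ ρ : R, 0 ≤ intersection D (boundaryDivisor ρ)) {u v : R} {m : ℝ × ℝ}
    (huv : IsMaximalCone R u v)
    (h1 : dotR (toR u) m = -D u) (h2 : dotR (toR v) m = -D v) : m ∈ polytope D := by
  intro w
  by_cases huw : 0 < crossZ u w
  · exact le_dotR_vertex_of_crossZ_pos hR hD huv huw h1 h2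
  by_cases hwv : 0 < crossZ w v
  · exact le_dotR_vertex_of_crossZ_neg hR hD huv hwv h1 h2
  -- Now `w` lies in the cone opposite to that of `u` and `v`. One step, backwards if `w = -v` and
  -- forwards otherwise, reaches a cone to which the previous lemmas apply; the step does not
  -- increase `⟨w, m⟩`.
  rw [crossZ_swap] at huw hwv
  by_cases hvw : crossZ v w = 0
  · rcases eq_or_eq_neg_of_crossZ_eq_zero (hR.primitive _ w.2) (hR.primitive _ v.2)
      (by rw [crossZ_swap, hvw, neg_zero]) with h | h
    · rw [Subtype.ext h, h2]
    · have hwu : 0 < crossZ w u := by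
        have := huv.2.2.1
        rw [h]
        simp only [crossZ, Prod.fst_neg, Prod.snd_neg] at this ⊢
        linarith
      obtain ⟨π, hπ⟩ := hR.exists_prev u
      obtain ⟨m', h3, h4⟩ := exists_vertex hπ.2.2.1 (D π) (D u)
      have h7 := dotR_vertex hR hπ huv D h3 h4 h1 h2 w
      have h5 := le_dotR_vertex_of_crossZ_neg hR hD hπ hwu h3 h4
      have h6 : 0 ≤ intersection D (boundaryDivisor u) * crossZ w u :=
        mul_nonneg (hD u) (by exact_mod_cast hwu.le)
      rw [crossZ_swap, Int.cast_neg] at h7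
      linarith
  · have hvw' : 0 < crossZ v w := by omega
    obtain ⟨ν, hν⟩ := hR.exists_next v
    obtain ⟨m', h3, h4⟩ := exists_vertex hν.2.2.1 (D v) (D ν)
    rw [dotR_vertex hR huv hν D h1 h2 h3 h4 w]
    have h5 := le_dotR_vertex_of_crossZ_pos hR hD hν hvw' h3 h4
    have h6 : 0 ≤ intersection D (boundaryDivisor v) * crossZ v w :=
      mul_nonneg (hD v) (by exact_mod_cast hvw'.le)
    linarith

/-- Two points of the edge of `P(D)` corresponding to `ρ` have distance at most `D · D_ρ`. -/
theorem le_intersection_of_mem_polytopeEdge (hR : IsCompleteFan R) {ρ : R} {p q : ℝ × ℝ}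
    (hp : p ∈ polytopeEdge D ρ) (hq : q ∈ polytopeEdge D ρ) {s : ℝ}
    (hs : q - p = s • perp (toR ρ)) : s ≤ intersection D (boundaryDivisor ρ) := by
  obtain ⟨π, hπ⟩ := hR.exists_prev ρ
  obtain ⟨ν, hν⟩ := hR.exists_next ρ
  obtain ⟨m, h1, h2⟩ := exists_vertex hπ.2.2.1 (D π) (D ρ)
  obtain ⟨m', h3, h4⟩ := exists_vertex hν.2.2.1 (D ρ) (D ν)
  have hmm := vertex_sub_vertex hR hπ hν D h1 h2 h3 h4
  have hc : 0 < cross (toR π) (toR ρ) := by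
    rw [cross_toR]; exact_mod_cast hπ.2.2.1
  have hc' : 0 < cross (toR ρ) (toR ν) := by
    rw [cross_toR]; exact_mod_cast hν.2.2.1
  have hpν := hp.1 ν
  have hqπ := hq.1 π
  rw [← h4] at hpν
  rw [← h1] at hqπ
  have hpm : dotR (toR ρ) (p - m') = 0 := by
    have := hp.2
    rw [← h3] at this
    simp only [dotR, Prod.fst_sub, Prod.snd_sub] at this ⊢
    linarith
  -- Along `perp ρ`, the inequality of `ν` puts `p` at or beyond `m'`, and below that of `π` puts
  -- `q` at or before `m`; `m - m'` measures `D · D_ρ`.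
  have hpm' : p - m' = (dotR (toR ν) (p - m') / cross (toR ρ) (toR ν)) • perp (toR ρ) := by
    have := hc'.ne'
    apply Prod.ext <;> simp only [Prod.smul_fst, Prod.smul_snd, smul_eq_mul] <;> field_simp <;>
      simp only [dotR, cross, perp] at hpm ⊢
    · linear_combination (toR ν).2 * hpm
    · linear_combination (-(toR ν).1) * hpm
  have ha : 0 ≤ dotR (toR ν) (p - m') / cross (toR ρ) (toR ν) := by
    refine div_nonneg ?_ hc'.le
    simp only [dotR, Prod.fst_sub, Prod.snd_sub] at hpν ⊢
    linarith
  generalize dotR (toR ν) (p - m') / cross (toR ρ) (toR ν) = a at hpm' ha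
  have hqm : q - m = (s + a - intersection D (boundaryDivisor ρ)) • perp (toR ρ) := by
    rw [sub_smul, add_smul, ← hs, ← hpm', ← hmm]; abel
  have hb : 0 ≤ (s + a - intersection D (boundaryDivisor ρ)) * cross (toR ρ) (toR π) := by
    rw [← dotR_perp]
    have : dotR (toR π) (q - m) =
        (s + a - intersection D (boundaryDivisor ρ)) * dotR (toR π) (perp (toR ρ)) := by
      rw [hqm]; simp only [dotR, Prod.smul_fst, Prod.smul_snd, smul_eq_mul]; ring
    rw [← this]
    simp only [dotR, Prod.fst_sub, Prod.snd_sub] at hqπ ⊢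
    linarith
  rw [cross_swap, mul_neg, ← neg_mul] at hb
  have := nonneg_of_mul_nonneg_left hb hc
  linarith

theorem exists_mem_polytopeEdge_sub_eq (hR : IsCompleteFan R)
    (hD : ∀ ρ : R, 0 ≤ intersection D (boundaryDivisor ρ)) (ρ : R) :
    ∃ p ∈ polytopeEdge D ρ, ∃ q ∈ polytopeEdge D ρ,
      q - p = intersection D (boundaryDivisor ρ) • perp (toR ρ) := by
  obtain ⟨π, hπ⟩ := hR.exists_prev ρ
  obtain ⟨ν, hν⟩ := hR.exists_next ρ
  obtain ⟨m, h1, h2⟩ := exists_vertex hπ.2.2.1 (D π) (D ρ)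
  obtain ⟨m', h3, h4⟩ := exists_vertex hν.2.2.1 (D ρ) (D ν)
  exact ⟨m', ⟨vertex_mem_polytope hR hD hν h3 h4, h3⟩, m,
    ⟨vertex_mem_polytope hR hD hπ h1 h2, h2⟩, vertex_sub_vertex hR hπ hν D h1 h2 h3 h4⟩

theorem latticeLength_nonneg (u : ℤ × ℤ) (F : Set (ℝ × ℝ)) : 0 ≤ latticeLength u F := by
  unfold latticeLength
  rcases F.eq_empty_or_nonempty with rfl | ⟨p, hp⟩
  · simp
  by_cases hb : BddAbove {t : ℝ | ∃ p ∈ F, ∃ q ∈ F, q - p = t • perp (toR u)}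
  · exact le_csSup hb ⟨p, hp, p, hp, by simp⟩
  -- An unbounded supremum is `0` by convention.
  · rw [Real.sSup_of_not_bddAbove hb]

theorem isNef_iff_latticeLength (hR : IsCompleteFan R) (D : RDivisor R) :
    IsNef D ↔ ∀ ρ : R,
      intersection D (boundaryDivisor ρ) = latticeLength ρ (polytopeEdge D ρ) := by
  rw [isNef_iff hR]
  refine ⟨fun h ρ => ?_, fun h ρ => by rw [h]; exact latticeLength_nonneg _ _⟩
  symm
  apply IsGreatest.csSup_eq
  refine ⟨exists_mem_polytopeEdge_sub_eq hR h ρ, ?_⟩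
  rintro s ⟨p, hp, q, hq, hs⟩
  exact le_intersection_of_mem_polytopeEdge hR hp hq hs

theorem polytopeEdge_nonempty (hR : IsCompleteFan R) (hD : IsNef D) (ρ : R) :
    (polytopeEdge D ρ).Nonempty := by
  obtain ⟨p, hp, -⟩ := exists_mem_polytopeEdge_sub_eq hR ((isNef_iff hR D).1 hD) ρ
  exact ⟨p, hp⟩

end

/-! # Edges and support points of convex polygons -/

theorem isSupportPoint_iff {S : Set (ℝ × ℝ)} {v p : ℝ × ℝ} :
    IsSupportPoint S v p ↔ p ∈ S ∧ ∀ q ∈ S, cross v q ≤ cross v p := by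
  refine and_congr_right fun _ => forall₂_congr fun q _ => ?_
  rw [cross_swap, cross_sub_right]
  constructor <;> intro h <;> linarith

theorem isSupportPoint_smul {S : Set (ℝ × ℝ)} {v p : ℝ × ℝ} {t : ℝ} (ht : 0 < t) :
    IsSupportPoint S (t • v) p ↔ IsSupportPoint S v p := by
  simp only [isSupportPoint_iff, cross_smul_left, mul_le_mul_iff_right₀ ht]

theorem isSupportPoint_convexHull {V : Set (ℝ × ℝ)} {v p : ℝ × ℝ} (hp : p ∈ V)
    (h : ∀ q ∈ V, cross v q ≤ cross v p) : IsSupportPoint (convexHull ℝ V) v p := by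
  refine isSupportPoint_iff.2 ⟨subset_convexHull ℝ V hp, fun q hq => ?_⟩
  have hlin : IsLinearMap ℝ (cross v) :=
    ⟨fun x y => by simp only [cross, Prod.fst_add, Prod.snd_add]; ring,
      fun c x => cross_smul_right c v x⟩
  exact convexHull_min h (convex_halfSpace_le hlin (cross v p)) hq

theorem eq_smul_of_cross_eq_zero {w x : ℝ × ℝ} (hw : w ≠ 0) (h : cross w x = 0) :
    x = (dotR w x / dotR w w) • w := by
  have h0 : dotR w w ≠ 0 := (normSq_pos hw).ne'
  apply Prod.ext <;> simp only [Prod.smul_fst, Prod.smul_snd, smul_eq_mul] <;> field_simp <;>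
    simp only [dotR, cross] at h ⊢
  · linear_combination (-w.2) * h
  · linear_combination w.1 * h

/-- If a supporting line of a convex body contains two of its points, then it contains an edge. -/
theorem exists_smul_mem_edgeVectors {S : Set (ℝ × ℝ)} (hS : Convex ℝ S) (hc : IsCompact S)
    {w p q : ℝ × ℝ} (hw : w ≠ 0) (hpq : p ≠ q) (hp : IsSupportPoint S w p)
    (hq : IsSupportPoint S w q) : ∃ c : ℝ, 0 < c ∧ c • w ∈ edgeVectors S := by
  have hww : 0 < dotR w w := normSq_pos hw
  have hcont : Continuous fun s : ℝ => p + s • w := by fun_prop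
  -- `T` parametrizes the part of `S` on the supporting line. It is a compact interval, and the
  -- factor `c` is its length.
  set T : Set ℝ := (fun s : ℝ => p + s • w) ⁻¹' S with hT
  have hTc : IsCompact T := by
    have himg : IsCompact ((fun r => dotR w (r - p) / dotR w w) '' S) := by
      refine hc.image ?_
      unfold dotR
      fun_prop
    refine himg.of_isClosed_subset (hc.isClosed.preimage hcont) fun s hs => ⟨_, hs, ?_⟩
    have : dotR w (p + s • w - p) = s * dotR w w := by
      simp only [dotR, add_sub_cancel_left, Prod.smul_fst, Prod.smul_snd, smul_eq_mul]; ring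
    simp only [this]
    field_simp
  have hTconv : Convex ℝ T := by
    intro s hs t ht a b ha hb hab
    have := hS hs ht ha hb hab
    simp only [hT, Set.mem_preimage] at this ⊢
    convert this using 1
    have hb' : b = 1 - a := by linarith
    subst hb'
    simp only [smul_add, smul_smul, add_smul, sub_smul, one_smul, smul_eq_mul]
    abel
  have hmem : ∀ r, IsSupportPoint S w r → ∃ s ∈ T, r = p + s • w := by
    intro r hr
    have h0 : cross w (r - p) = 0 := by
      rw [cross_sub_right]
      have h1 := (isSupportPoint_iff.1 hr).2 p hp.1
      have h2 := (isSupportPoint_iff.1 hp).2 r hr.1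
      linarith
    have h1 : r = p + (dotR w (r - p) / dotR w w) • w := by
      rw [← eq_smul_of_cross_eq_zero hw h0]; abel
    refine ⟨_, ?_, h1⟩
    rw [hT, Set.mem_preimage, ← h1]
    exact hr.1
  have h0T : (0 : ℝ) ∈ T := by simpa [hT] using hp.1
  obtain ⟨s, hsT, hs⟩ := hmem q hq
  have hs0 : s ≠ 0 := by
    rintro rfl
    exact hpq (by rw [hs]; simp)
  have ha := hTc.sInf_mem ⟨0, h0T⟩
  have hb := hTc.sSup_mem ⟨0, h0T⟩
  have hle : ∀ t ∈ T, sInf T ≤ t ∧ t ≤ sSup T := fun t ht =>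
    ⟨csInf_le hTc.bddBelow ht, le_csSup hTc.bddAbove ht⟩
  generalize sInf T = a at *
  generalize sSup T = b at *
  have hab : a < b := by
    have h1 := hle 0 h0T
    have h2 := hle s hsT
    rcases lt_or_gt_of_ne hs0 with h | h <;> linarith
  have hc : 0 < b - a := by linarith
  refine ⟨b - a, hc, smul_ne_zero hc.ne' hw, p + a • w, ?_⟩
  ext r
  simp only [Set.mem_ofPred_eq, isSupportPoint_smul hc, segment_eq_image', Set.mem_image]
  constructor
  · intro hr
    obtain ⟨t, htT, rfl⟩ := hmem r hr
    obtain ⟨h1, h2⟩ := hle t htT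
    refine ⟨(t - a) / (b - a), ⟨div_nonneg (by linarith) hc.le,
      (div_le_one hc).2 (by linarith)⟩, ?_⟩
    rw [add_sub_cancel_left, smul_smul, div_mul_cancel₀ _ hc.ne', sub_smul]
    abel
  · rintro ⟨θ, ⟨h0, h1⟩, rfl⟩
    have hin : a + θ * (b - a) ∈ T := by
      refine hTconv.ordConnected.out ha hb ⟨?_, ?_⟩
      · nlinarith
      · nlinarith
    have heq : p + a • w + θ • (p + a • w + (b - a) • w - (p + a • w)) =
        p + (a + θ * (b - a)) • w := by
      rw [add_sub_cancel_left, smul_smul, add_smul]; abel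
    rw [heq]
    refine isSupportPoint_iff.2 ⟨hin, fun q hq => ?_⟩
    have h2 := (isSupportPoint_iff.1 hp).2 q hq
    have h3 : cross w (p + (a + θ * (b - a)) • w) = cross w p := by
      simp only [cross, Prod.fst_add, Prod.snd_add, Prod.smul_fst, Prod.smul_snd, smul_eq_mul]
      ring
    rw [h3]; exact h2

/-- A face of a face is a face. The vectors `w` and `e` are independent parameters so that reversing
the segment also covers its other endpoint. -/
theorem left_mem_extremePoints_of_face {S : Set (ℝ × ℝ)} {w e q : ℝ × ℝ} (he : e ≠ 0)
    (h : {p | IsSupportPoint S w p} = segment ℝ q (q + e)) : q ∈ S.extremePoints ℝ := by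
  have hq : IsSupportPoint S w q := by
    have : q ∈ {p | IsSupportPoint S w p} := h ▸ left_mem_segment ℝ _ _
    exact this
  have hface : ∀ r, IsSupportPoint S w r → ∃ s : ℝ, 0 ≤ s ∧ r = q + s • e := by
    intro r hr
    have : r ∈ segment ℝ q (q + e) := h ▸ hr
    rw [segment_eq_image', add_sub_cancel_left] at this
    obtain ⟨s, hs, rfl⟩ := this
    exact ⟨s, hs.1, rfl⟩
  refine mem_extremePoints.2 ⟨hq.1, fun x hx y hy hxy => ?_⟩
  obtain ⟨a, b, ha, hb, hab, hq'⟩ := hxy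
  have hmax := (isSupportPoint_iff.1 hq).2
  have hcr : a * cross w x + b * cross w y = cross w q := by
    rw [← cross_comb_right, hq']
  have hx1 := hmax x hx
  have hy1 := hmax y hy
  have hcr' : a * (cross w q - cross w x) + b * (cross w q - cross w y) = 0 := by
    linear_combination (cross w q) * hab - hcr
  have hx2 : cross w x = cross w q := by
    have h1 := mul_nonneg hb.le (sub_nonneg.2 hy1)
    have h2 := mul_nonneg ha.le (sub_nonneg.2 hx1)
    have h3 : a * (cross w q - cross w x) = 0 := by linarith
    have := (mul_eq_zero.1 h3).resolve_left ha.ne'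
    linarith
  have hy2 : cross w y = cross w q := by
    rw [hx2, sub_self, mul_zero, zero_add] at hcr'
    have := (mul_eq_zero.1 hcr').resolve_left hb.ne'
    linarith
  obtain ⟨s, hs, rfl⟩ := hface x (isSupportPoint_iff.2 ⟨hx, fun z hz => hx2 ▸ hmax z hz⟩)
  obtain ⟨t, ht, rfl⟩ := hface y (isSupportPoint_iff.2 ⟨hy, fun z hz => hy2 ▸ hmax z hz⟩)
  have hst : (a * s + b * t) • e = 0 := by
    have : a • (q + s • e) + b • (q + t • e) = q + (a * s + b * t) • e := by
      have hb' : b = 1 - a := by linarith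
      subst hb'
      module
    rw [this] at hq'
    simpa using hq'
  have hst' := (smul_eq_zero.1 hst).resolve_right he
  have h1 := mul_nonneg ha.le hs
  have h2 := mul_nonneg hb.le ht
  have hs0 : s = 0 := (mul_eq_zero.1 (by linarith : a * s = 0)).resolve_left ha.ne'
  have ht0 : t = 0 := (mul_eq_zero.1 (by linarith : b * t = 0)).resolve_left hb.ne'
  simp [hs0, ht0]

/-- Endpoints of edges are extreme points, which belong to `V`. Finiteness and rationality of the
edge vectors rest on this. -/
theorem exists_eq_sub_of_mem_edgeVectors {V : Set (ℝ × ℝ)} {e : ℝ × ℝ}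
    (he : e ∈ edgeVectors (convexHull ℝ V)) : ∃ x ∈ V, ∃ y ∈ V, e = y - x := by
  obtain ⟨he0, q, hq⟩ := he
  refine ⟨q, extremePoints_convexHull_subset (left_mem_extremePoints_of_face he0 hq), q + e,
    extremePoints_convexHull_subset (left_mem_extremePoints_of_face (w := e) (e := -e)
      (neg_ne_zero.2 he0) ?_), by abel⟩
  rw [hq, segment_symm, add_neg_cancel_right]

/-- A lexicographic maximum with respect to the directions `u` and `v`. -/
theorem exists_lex_max {V : Set (ℝ × ℝ)} (hV : V.Finite) (hne : V.Nonempty) (u v : ℝ × ℝ) :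
    ∃ p ∈ V, (∀ q ∈ V, cross u q ≤ cross u p) ∧
      ∀ q ∈ V, cross u q = cross u p → cross v q ≤ cross v p := by
  obtain ⟨p₀, hp₀, h₀⟩ := Set.exists_max_image V (cross u) hV hne
  obtain ⟨p, ⟨hp, hup⟩, h⟩ := Set.exists_max_image {q | q ∈ V ∧ cross u q = cross u p₀} (cross v)
    (hV.subset fun _ h => h.1) ⟨p₀, hp₀, rfl⟩
  exact ⟨p, hp, fun q hq => hup ▸ h₀ q hq, fun q hq hqp => h q ⟨hq, hqp.trans hup⟩⟩

/-- Rotating the supporting line at a lexicographic maximum `p` until it meets another point, one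
obtains the next edge at `p`. -/
theorem exists_edge_at_lex_max {V : Set (ℝ × ℝ)} (hV : V.Finite) {u v p : ℝ × ℝ}
    (huv : 0 < cross u v) (hp : p ∈ V) (hu : ∀ q ∈ V, cross u q ≤ cross u p)
    (hv : ∀ q ∈ V, cross u q = cross u p → cross v q ≤ cross v p)
    (hne : ∃ q ∈ V, cross u q < cross u p) :
    ∃ t : ℝ, IsSupportPoint (convexHull ℝ V) (v + t • u) p ∧
      ∃ c : ℝ, 0 < c ∧ c • (v + t • u) ∈ edgeVectors (convexHull ℝ V) := by
  obtain ⟨q₀, hq₀, hq₀p⟩ := hne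
  -- The maximum `t` of these quotients is the least value for which `p` still maximizes `cross (v +
  -- t • u)` on `V`; there `q` ties with `p`.
  obtain ⟨q, ⟨hq, hqp⟩, hmax⟩ := Set.exists_max_image {q | q ∈ V ∧ cross u q < cross u p}
    (fun q => (cross v q - cross v p) / (cross u p - cross u q))
    (hV.subset fun _ h => h.1) ⟨q₀, hq₀, hq₀p⟩
  have hexp : ∀ t r, cross (v + t • u) r = cross v r + t * cross u r := fun t r => by
    simp only [cross, Prod.fst_add, Prod.snd_add, Prod.smul_fst, Prod.smul_snd, smul_eq_mul]
    ring
  obtain ⟨t, ht⟩ : ∃ t, t = (cross v q - cross v p) / (cross u p - cross u q) := ⟨_, rfl⟩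
  have hsup : ∀ r ∈ V, cross (v + t • u) r ≤ cross (v + t • u) p := by
    intro r hr
    rw [hexp, hexp]
    rcases (hu r hr).lt_or_eq with h | h
    · have h1 := hmax r ⟨hr, h⟩
      rw [← ht, div_le_iff₀ (by linarith)] at h1
      linarith
    · have := hv r hr h
      rw [h]; linarith
  have heq : cross (v + t • u) q = cross (v + t • u) p := by
    rw [eq_div_iff (by linarith)] at ht
    rw [hexp, hexp]; linarith
  have hw : v + t • u ≠ 0 := by
    intro h
    have h1 : cross u (v + t • u) = cross u v := by
      simp only [cross, Prod.fst_add, Prod.snd_add, Prod.smul_fst, Prod.smul_snd, smul_eq_mul]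
      ring
    rw [h] at h1
    simp only [cross, Prod.fst_zero, Prod.snd_zero, mul_zero, sub_zero] at h1
    simp only [cross] at huv
    linarith
  refine ⟨t, isSupportPoint_convexHull hp hsup, exists_smul_mem_edgeVectors
    (convex_convexHull ℝ V) (hV.isCompact_convexHull (𝕜 := ℝ)) hw (p := p) (q := q) ?_
    (isSupportPoint_convexHull hp hsup)
    (isSupportPoint_convexHull hq fun r hr => heq ▸ hsup r hr)⟩
  rintro rfl
  exact lt_irrefl _ hqp

/-- If no edge of a polygon has its direction strictly between `u` and `v`, then there is a common
support point in the directions `u` and `v`. -/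
theorem exists_common_isSupportPoint {S : Set (ℝ × ℝ)} (hS : IsPolygon S) {u v : ℝ × ℝ}
    (huv : 0 < cross u v) (h : ∀ e ∈ edgeVectors S, 0 < cross u e → cross e v ≤ 0) :
    ∃ p, IsSupportPoint S u p ∧ IsSupportPoint S v p := by
  obtain ⟨V, hV, hne, rfl⟩ := hS
  obtain ⟨p, hp, hu, hv⟩ := exists_lex_max hV hne u v
  refine ⟨p, isSupportPoint_convexHull hp hu, isSupportPoint_convexHull hp ?_⟩
  by_contra! hcon
  obtain ⟨q, hq, hqp⟩ := hcon
  have hqu : cross u q < cross u p :=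
    lt_of_le_of_ne (hu q hq) fun he => (hv q hq he).not_gt hqp
  -- As `q` beats `p` in direction `v`, the edge direction `v + t • u` has `t > 0`, so it lies
  -- strictly between `u` and `v`.
  obtain ⟨t, hsup, c, hc, hedge⟩ := exists_edge_at_lex_max hV huv hp hu hv ⟨q, hq, hqu⟩
  have h1 := (isSupportPoint_iff.1 hsup).2 q (subset_convexHull ℝ V hq)
  have h2 : cross (v + t • u) q = cross v q + t * cross u q := by
    simp only [cross, Prod.fst_add, Prod.snd_add, Prod.smul_fst, Prod.smul_snd, smul_eq_mul]
    ring
  have h3 : cross (v + t • u) p = cross v p + t * cross u p := by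
    simp only [cross, Prod.fst_add, Prod.snd_add, Prod.smul_fst, Prod.smul_snd, smul_eq_mul]
    ring
  have ht : 0 < t := by
    rw [h2, h3] at h1
    by_contra! ht
    nlinarith
  have h4 : cross u (c • (v + t • u)) = c * cross u v := by
    simp only [cross, Prod.fst_add, Prod.snd_add, Prod.smul_fst, Prod.smul_snd, smul_eq_mul]
    ring
  have h5 : cross (c • (v + t • u)) v = c * (t * cross u v) := by
    simp only [cross, Prod.fst_add, Prod.snd_add, Prod.smul_fst, Prod.smul_snd, smul_eq_mul]
    ring
  have h6 := h _ hedge (by rw [h4]; positivity)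
  rw [h5] at h6
  have : 0 < c * (t * cross u v) := by positivity
  linarith

/-! # The fan of slopes of a rational polygon -/

theorem exists_primitive_of_rat {a b : ℚ} (h : ((a : ℝ), (b : ℝ)) ≠ (0 : ℝ × ℝ)) :
    ∃ v : ℤ × ℤ, IsCoprime v.1 v.2 ∧ ∃ c : ℝ, 0 < c ∧ ((a : ℝ), (b : ℝ)) = c • toR v := by
  have hne : ¬(a.num * b.den = 0 ∧ b.num * a.den = 0) := by
    rintro ⟨h1, h2⟩
    apply h
    have ha : a = 0 := by simpa using h1
    have hb : b = 0 := by simpa using h2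
    simp [ha, hb]
  have hg : 0 < Int.gcd (a.num * b.den) (b.num * a.den) := by
    rw [Int.gcd_pos_iff]
    tauto
  obtain ⟨x, y, hxy, hx, hy⟩ := Int.exists_gcd_one hg
  set g := Int.gcd (a.num * b.den) (b.num * a.den)
  have hda : (0 : ℝ) < a.den := by exact_mod_cast a.pos
  have hdb : (0 : ℝ) < b.den := by exact_mod_cast b.pos
  have hx' : (a.num : ℝ) * b.den = x * g := by exact_mod_cast hx
  have hy' : (b.num : ℝ) * a.den = y * g := by exact_mod_cast hy
  -- Multiplying by both denominators gives an integral vector, and dividing by its gcd `g` a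
  -- primitive one.
  refine ⟨(x, y), Int.isCoprime_iff_gcd_eq_one.2 hxy, g / (a.den * b.den), by positivity, ?_⟩
  apply Prod.ext <;> simp only [toR, Prod.smul_fst, Prod.smul_snd, smul_eq_mul]
  · rw [Rat.cast_def]
    field_simp
    linarith
  · rw [Rat.cast_def]
    field_simp
    linarith

theorem IsRationalPolygon.isPolygon {Ω : Set (ℝ × ℝ)} (h : IsRationalPolygon Ω) :
    IsPolygon Ω := by
  obtain ⟨⟨V, hV⟩, hint⟩ := h
  refine ⟨_, V.finite_toSet.image _, ?_, hV⟩
  rw [← convexHull_nonempty_iff (𝕜 := ℝ), ← hV]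
  exact hint.mono interior_subset

theorem IsRationalPolygon.exists_slope {Ω : Set (ℝ × ℝ)} (h : IsRationalPolygon Ω) {e : ℝ × ℝ}
    (he : e ∈ edgeVectors Ω) : ∃ v ∈ slopes Ω, ∃ c : ℝ, 0 < c ∧ e = c • toR v := by
  obtain ⟨⟨V, hV⟩, -⟩ := h
  obtain ⟨_, ⟨x, -, rfl⟩, _, ⟨y, -, rfl⟩, hxy⟩ := exists_eq_sub_of_mem_edgeVectors (hV ▸ he)
  have hrat : e = (((y.1 - x.1 : ℚ) : ℝ), ((y.2 - x.2 : ℚ) : ℝ)) := by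
    rw [hxy]; simp
  obtain ⟨v, hv, c, hc, hcv⟩ := exists_primitive_of_rat (hrat ▸ he.1)
  rw [← hrat] at hcv
  refine ⟨v, ⟨hv, e, he, ?_⟩, c, hc, hcv⟩
  rw [hcv]
  exact SameRay.sameRay_pos_smul_right _ hc

theorem exists_smul_of_mem_slopes {Ω : Set (ℝ × ℝ)} {v : ℤ × ℤ} (hv : v ∈ slopes Ω) :
    ∃ e ∈ edgeVectors Ω, ∃ c : ℝ, 0 < c ∧ toR v = c • e := by
  obtain ⟨hcop, e, he, hray⟩ := hv
  obtain ⟨r, s, hr, hs, hrs⟩ := hray.exists_pos (toR_ne_zero hcop) he.1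
  refine ⟨e, he, r⁻¹ * s, by positivity, ?_⟩
  rw [mul_smul, ← hrs, inv_smul_smul₀ hr.ne']

theorem IsPolygon.finite_edgeVectors {S : Set (ℝ × ℝ)} (h : IsPolygon S) :
    (edgeVectors S).Finite := by
  obtain ⟨V, hV, -, rfl⟩ := h
  refine ((hV.prod hV).image fun z => z.2 - z.1).subset fun e he => ?_
  obtain ⟨x, hx, y, hy, rfl⟩ := exists_eq_sub_of_mem_edgeVectors he
  exact ⟨(x, y), ⟨hx, hy⟩, rfl⟩

theorem IsPolygon.finite_slopes {S : Set (ℝ × ℝ)} (h : IsPolygon S) : (slopes S).Finite := by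
  have hex : ∀ v ∈ slopes S, ∃ e ∈ edgeVectors S, ∃ c : ℝ, 0 < c ∧ toR v = c • e :=
    fun v hv => exists_smul_of_mem_slopes hv
  choose! f hf using hex
  refine Set.Finite.of_injOn (f := f) (fun v hv => (hf v hv).1) (fun v hv w hw hvw => ?_)
    h.finite_edgeVectors
  obtain ⟨-, c, hc, hcv⟩ := hf v hv
  obtain ⟨-, d, hd, hdw⟩ := hf w hw
  refine eq_of_toR_eq_smul hv.1 hw.1 (r := c * d⁻¹) (by positivity) ?_
  rw [hcv, hdw, hvw, smul_smul, inv_mul_cancel_right₀ hd.ne']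

theorem exists_cross_ne_of_interior_nonempty {S : Set (ℝ × ℝ)} (hS : (interior S).Nonempty)
    {x : ℝ × ℝ} (hx : x ≠ 0) (a : ℝ) : ∃ q ∈ S, cross x q ≠ a := by
  by_contra! hcon
  obtain ⟨z, hz⟩ := hS
  have hcont : Continuous fun t : ℝ => z + t • perp x := by fun_prop
  have hev : ∀ᶠ t : ℝ in nhds 0, z + t • perp x ∈ S := by
    have h0 : S ∈ nhds (z + (0 : ℝ) • perp x) := by
      simpa using mem_interior_iff_mem_nhds.1 hz
    exact hcont.continuousAt.eventually h0
  obtain ⟨t, ht, ht0⟩ := ((hev.filter_mono nhdsWithin_le_nhds).and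
    (self_mem_nhdsWithin (a := (0 : ℝ)) (s := {0}ᶜ))).exists
  have h1 := hcon _ ht
  have h2 := hcon z (interior_subset hz)
  have h3 : cross x (z + t • perp x) = cross x z + t * (x.1 * x.1 + x.2 * x.2) := by
    simp only [cross, perp, Prod.fst_add, Prod.snd_add, Prod.smul_fst, Prod.smul_snd,
      smul_eq_mul]
    ring
  rw [h1, h2] at h3
  have h4 : t * (x.1 * x.1 + x.2 * x.2) = 0 := by linarith
  rcases mul_eq_zero.1 h4 with h | h
  · exact ht0 h
  · exact (normSq_pos hx).ne' h

/-- Turning the supporting line from direction `x` to the next edge gives an edge direction `perp x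
+ t • x`, whose cross product with `x` is positive. The interior ensures that not all vertices lie
on the starting line. -/
theorem IsRationalPolygon.isCompleteFan_slopes {Ω : Set (ℝ × ℝ)} (h : IsRationalPolygon Ω) :
    IsCompleteFan (slopes Ω) := by
  refine isCompleteFan_of_forall_exists_cross_pos h.isPolygon.finite_slopes (fun u hu => hu.1)
    fun x hx => ?_
  obtain ⟨V, hV, hne, hΩ⟩ := h.isPolygon
  obtain ⟨p, hp, hu, hv⟩ := exists_lex_max hV hne x (perp x)
  have hlt : ∃ q ∈ V, cross x q < cross x p := by
    by_contra! hcon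
    have h1 : IsSupportPoint Ω (-x) p := hΩ ▸ isSupportPoint_convexHull hp fun q hq => by
      rw [cross_neg_left, cross_neg_left]; linarith [hcon q hq]
    have h2 : IsSupportPoint Ω x p := hΩ ▸ isSupportPoint_convexHull hp hu
    obtain ⟨q, hq, hqp⟩ := exists_cross_ne_of_interior_nonempty h.2 hx (cross x p)
    have h3 := (isSupportPoint_iff.1 h1).2 q hq
    have h4 := (isSupportPoint_iff.1 h2).2 q hq
    rw [cross_neg_left, cross_neg_left] at h3
    exact hqp (by linarith)
  have hpos : 0 < cross x (perp x) := by rw [cross_perp]; exact normSq_pos hx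
  obtain ⟨t, -, c, hc, hedge⟩ := exists_edge_at_lex_max hV hpos hp hu hv hlt
  obtain ⟨w, hw, d, hd, hdw⟩ := h.exists_slope (hΩ ▸ hedge)
  refine ⟨w, hw, ?_⟩
  have h1 : cross x (c • (perp x + t • x)) = c * cross x (perp x) := by
    simp only [cross, Prod.fst_add, Prod.snd_add, Prod.smul_fst, Prod.smul_snd, smul_eq_mul]
    ring
  rw [hdw, cross_smul_right] at h1
  exact pos_of_mul_pos_right (h1 ▸ mul_pos hc hpos) hd.le

/-! # The divisor of a polygon -/

theorem dotR_perp_eq_neg (w y : ℝ × ℝ) : dotR w (perp y) = -cross w y := by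
  rw [dotR_perp, cross_swap]

theorem perp_sub (p q : ℝ × ℝ) : perp (p - q) = perp p - perp q := by
  ext <;> simp [perp]; ring

theorem perp_smul (c : ℝ) (p : ℝ × ℝ) : perp (c • p) = c • perp p := by
  ext <;> simp [perp]

theorem perp_injective : Function.Injective perp := by
  intro p q h
  have h1 := congrArg Prod.fst h
  have h2 := congrArg Prod.snd h
  simp only [perp, neg_inj] at h1 h2
  exact Prod.ext h2 h1

theorem IsPolygon.exists_isSupportPoint {S : Set (ℝ × ℝ)} (hS : IsPolygon S) (v : ℝ × ℝ) :
    ∃ p, IsSupportPoint S v p := by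
  obtain ⟨V, hV, hne, rfl⟩ := hS
  obtain ⟨p, hp, h⟩ := Set.exists_max_image V (cross v) hV hne
  exact ⟨p, isSupportPoint_convexHull hp h⟩

theorem IsPolygon.cross_le_omegaLength {S : Set (ℝ × ℝ)} (hS : IsPolygon S) (v : ℝ × ℝ)
    {q : ℝ × ℝ} (hq : q ∈ S) : cross v q ≤ omegaLength S v := by
  obtain ⟨p, hp⟩ := hS.exists_isSupportPoint v
  rw [omegaLength_eq hp]
  exact (isSupportPoint_iff.1 hp).2 q hq

theorem IsPolygon.isSupportPoint_iff_omegaLength {S : Set (ℝ × ℝ)} (hS : IsPolygon S)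
    {v p : ℝ × ℝ} : IsSupportPoint S v p ↔ p ∈ S ∧ cross v p = omegaLength S v := by
  refine ⟨fun h => ⟨h.1, (omegaLength_eq h).symm⟩, fun h => isSupportPoint_iff.2
    ⟨h.1, fun q hq => ?_⟩⟩
  rw [h.2]
  exact hS.cross_le_omegaLength v hq

theorem IsPolygon.omegaLength_smul {S : Set (ℝ × ℝ)} (hS : IsPolygon S) {c : ℝ} (hc : 0 < c)
    (v : ℝ × ℝ) : omegaLength S (c • v) = c * omegaLength S v := by
  obtain ⟨p, hp⟩ := hS.exists_isSupportPoint v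
  rw [omegaLength_eq hp, omegaLength_eq ((isSupportPoint_smul hc).2 hp), cross_smul_left]

theorem IsPolygon.convex {S : Set (ℝ × ℝ)} (hS : IsPolygon S) : Convex ℝ S := by
  obtain ⟨V, -, -, rfl⟩ := hS
  exact convex_convexHull ℝ V

theorem IsPolygon.isCompact {S : Set (ℝ × ℝ)} (hS : IsPolygon S) : IsCompact S := by
  obtain ⟨V, hV, -, rfl⟩ := hS
  exact hV.isCompact_convexHull (𝕜 := ℝ)

/-! ### Polygons with edges parallel to those of `Ω` -/

theorem EdgesParallel.exists_slope {Ω Λ : Set (ℝ × ℝ)} (hΩ : IsRationalPolygon Ω)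
    (hpar : EdgesParallel Λ Ω) {e : ℝ × ℝ} (he : e ∈ edgeVectors Λ) :
    ∃ v ∈ slopes Ω, ∃ c : ℝ, 0 < c ∧ e = c • toR v := by
  obtain ⟨e', he', hray⟩ := hpar e he
  obtain ⟨v, hv, c, hc, rfl⟩ := hΩ.exists_slope he'
  obtain ⟨r, s, hr, hs, hrs⟩ := hray.exists_pos he.1 he'.1
  refine ⟨v, hv, r⁻¹ * s * c, by positivity, ?_⟩
  rw [mul_smul, mul_smul, ← hrs, inv_smul_smul₀ hr.ne']

section

variable {Ω Λ : Set (ℝ × ℝ)}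

theorem exists_common_isSupportPoint_of_isMaximalCone (hΩ : IsRationalPolygon Ω)
    (hΛ : IsPolygon Λ) (hpar : EdgesParallel Λ Ω) {u v : ℤ × ℤ}
    (huv : IsMaximalCone (slopes Ω) u v) :
    ∃ p, IsSupportPoint Λ (toR u) p ∧ IsSupportPoint Λ (toR v) p := by
  refine exists_common_isSupportPoint hΛ (by rw [cross_toR]; exact_mod_cast huv.2.2.1) ?_
  intro e he hue
  by_contra! hev
  obtain ⟨w, hw, c, hc, rfl⟩ := hpar.exists_slope hΩ he
  rw [cross_smul_right, cross_toR] at hue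
  rw [cross_smul_left, cross_toR] at hev
  have h1 : 0 < crossZ u w := by exact_mod_cast pos_of_mul_pos_right hue hc.le
  have h2 : 0 < crossZ w v := by exact_mod_cast pos_of_mul_pos_right hev hc.le
  rcases huv.eq_or_eq_of_crossZ_nonneg hw h1.le h2.le with rfl | rfl
  · exact h1.ne' (crossZ_self _)
  · exact h2.ne' (crossZ_self _)

theorem IsSupportPoint.dotR_perp_eq {R : Set (ℤ × ℤ)} {ρ : R} {p : ℝ × ℝ}
    (h : IsSupportPoint Λ (toR ρ) p) : dotR (toR ρ) (perp p) = -polygonDivisor R Λ ρ := by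
  rw [polygonDivisor, omegaLength_eq h, dotR_perp_eq_neg]

/-- The vertices at the two cones of `ρ` are `perp p` and `perp q` with `p, q ∈ Λ`, and `p` is
extremal in direction `π`; comparing it with `q` gives the sign. -/
theorem intersection_polygonDivisor_nonneg (hΩ : IsRationalPolygon Ω) (hΛ : IsPolygon Λ)
    (hpar : EdgesParallel Λ Ω) (ρ : slopes Ω) :
    0 ≤ intersection (polygonDivisor (slopes Ω) Λ) (boundaryDivisor ρ) := by
  have hR := hΩ.isCompleteFan_slopes
  obtain ⟨π, hπ⟩ := hR.exists_prev ρ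
  obtain ⟨ν, hν⟩ := hR.exists_next ρ
  obtain ⟨p, hp1, hp2⟩ := exists_common_isSupportPoint_of_isMaximalCone hΩ hΛ hpar hπ
  obtain ⟨q, hq1, hq2⟩ := exists_common_isSupportPoint_of_isMaximalCone hΩ hΛ hpar hν
  have h := dotR_vertex hR hπ hν _ hp1.dotR_perp_eq hp2.dotR_perp_eq hq1.dotR_perp_eq
    hq2.dotR_perp_eq π
  rw [dotR_perp_eq_neg, dotR_perp_eq_neg, crossZ_swap, Int.cast_neg] at h
  have h1 := (isSupportPoint_iff.1 hp1).2 q hq1.1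
  have hc : (0 : ℝ) < crossZ π ρ := by exact_mod_cast hπ.2.2.1
  refine nonneg_of_mul_nonneg_left (b := (crossZ π ρ : ℝ)) ?_ hc
  linarith

theorem polytope_polygonDivisor (hΩ : IsRationalPolygon Ω) (hΛ : IsPolygon Λ)
    (hpar : EdgesParallel Λ Ω) : polytope (polygonDivisor (slopes Ω) Λ) = perp '' Λ := by
  apply Set.Subset.antisymm
  · intro x hx
    obtain ⟨y, rfl⟩ : ∃ y, perp y = x := ⟨(x.2, -x.1), by simp [perp]⟩
    refine ⟨y, ?_, rfl⟩
    by_contra hy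
    obtain ⟨f, b, hf, hfy⟩ := geometric_hahn_banach_closed_point hΛ.convex
      hΛ.isCompact.isClosed hy
    obtain ⟨w, hw⟩ : ∃ w : ℝ × ℝ, ∀ z, f z = cross w z := by
      refine ⟨(f (0, 1), -f (1, 0)), fun z => ?_⟩
      have hz : z = z.1 • ((1, 0) : ℝ × ℝ) + z.2 • ((0, 1) : ℝ × ℝ) := by ext <;> simp
      conv_lhs => rw [hz, map_add, map_smul, map_smul]
      simp only [cross, smul_eq_mul]; ring
    -- With `w = α u + β v` in a cone, the common support point attains `α ℓ_Λ(u) + β ℓ_Λ(v)`, which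
    -- bounds `w × y`; so `w` cannot separate `y` from `Λ`.
    obtain ⟨u, v, huv, α, β, hα, hβ, rfl⟩ := hΩ.isCompleteFan_slopes.complete w
    obtain ⟨p, hp1, hp2⟩ := exists_common_isSupportPoint_of_isMaximalCone hΩ hΛ hpar huv
    have h1 := hf p hp1.1
    have hu := hx ⟨u, huv.1⟩
    have hv := hx ⟨v, huv.2.1⟩
    simp only [polygonDivisor, dotR_perp_eq_neg, omegaLength_eq hp1, omegaLength_eq hp2] at hu hv
    rw [hw, cross_comb_left] at h1 hfy
    have h2 := mul_le_mul_of_nonneg_left (neg_le_neg_iff.1 hu) hα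
    have h3 := mul_le_mul_of_nonneg_left (neg_le_neg_iff.1 hv) hβ
    linarith
  · rintro _ ⟨y, hy, rfl⟩ ρ
    rw [dotR_perp_eq_neg]
    exact neg_le_neg (hΛ.cross_le_omegaLength _ hy)

theorem isNef_polygonDivisor (hΩ : IsRationalPolygon Ω) (hΛ : IsPolygon Λ)
    (hpar : EdgesParallel Λ Ω) : IsNef (polygonDivisor (slopes Ω) Λ) :=
  (isNef_iff hΩ.isCompleteFan_slopes _).2 (intersection_polygonDivisor_nonneg hΩ hΛ hpar)

/-- A nef divisor is determined by its polytope. -/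
theorem eq_polygonDivisor_of_isNef {R : Set (ℤ × ℤ)} (hR : IsCompleteFan R)
    {D : RDivisor R} (hD : IsNef D) (hpoly : polytope D = perp '' Λ) :
    D = polygonDivisor R Λ := by
  funext ρ
  -- Nefness makes the inequality of `ρ` tight somewhere on the polytope, so the coefficient can be
  -- read off.
  obtain ⟨x, hx, hxρ⟩ := polytopeEdge_nonempty hR hD ρ
  rw [hpoly] at hx
  obtain ⟨p, hp, rfl⟩ := hx
  have hsup : IsSupportPoint Λ (toR ρ) p := by
    refine isSupportPoint_iff.2 ⟨hp, fun q hq => ?_⟩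
    have : perp q ∈ polytope D := hpoly ▸ ⟨q, hq, rfl⟩
    have h1 := this ρ
    rw [← hxρ, dotR_perp_eq_neg, dotR_perp_eq_neg] at h1
    linarith
  have h := hsup.dotR_perp_eq (R := R)
  rw [hxρ] at h
  linarith

theorem mem_polytopeEdge_polygonDivisor (hΩ : IsRationalPolygon Ω) (hΛ : IsPolygon Λ)
    (hpar : EdgesParallel Λ Ω) {ρ : slopes Ω} {p : ℝ × ℝ} :
    perp p ∈ polytopeEdge (polygonDivisor (slopes Ω) Λ) ρ ↔ IsSupportPoint Λ (toR ρ) p := by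
  rw [hΛ.isSupportPoint_iff_omegaLength, polytopeEdge, Set.mem_ofPred_eq,
    polytope_polygonDivisor hΩ hΛ hpar, perp_injective.mem_set_image, dotR_perp_eq_neg, neg_inj,
    polygonDivisor]

/-- The length of an edge of `Λ` is an intersection number. -/
theorem eq_intersection_of_smul_mem_edgeVectors (hΩ : IsRationalPolygon Ω) (hΛ : IsPolygon Λ)
    (hpar : EdgesParallel Λ Ω) {ρ : slopes Ω} {c : ℝ} (hc : 0 < c)
    (h : c • toR ρ ∈ edgeVectors Λ) :
    c = intersection (polygonDivisor (slopes Ω) Λ) (boundaryDivisor ρ) := by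
  have hR := hΩ.isCompleteFan_slopes
  obtain ⟨-, q, hq⟩ := h
  simp only [isSupportPoint_smul hc] at hq
  have hmem : ∀ r, r ∈ segment ℝ q (q + c • toR ρ) ↔ IsSupportPoint Λ (toR ρ) r := fun r => by
    rw [← hq]; rfl
  apply le_antisymm
  · have h1 := (hmem _).1 (left_mem_segment ℝ _ _)
    have h2 := (hmem _).1 (right_mem_segment ℝ _ _)
    refine le_intersection_of_mem_polytopeEdge hR
      ((mem_polytopeEdge_polygonDivisor hΩ hΛ hpar).2 h1)
      ((mem_polytopeEdge_polygonDivisor hΩ hΛ hpar).2 h2) ?_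
    rw [← perp_sub, add_sub_cancel_left, perp_smul]
  -- Two points of the edge differ by `D_Λ · D_ρ` times the slope; as parameters `s, t ∈ [0, 1]` on
  -- the segment, they give `(t - s) c ≤ c`.
  · obtain ⟨x, hx, y, hy, hxy⟩ := exists_mem_polytopeEdge_sub_eq hR
      (intersection_polygonDivisor_nonneg hΩ hΛ hpar) ρ
    obtain ⟨a, rfl⟩ : ∃ a, perp a = x := ⟨(x.2, -x.1), by simp [perp]⟩
    obtain ⟨b, rfl⟩ : ∃ b, perp b = y := ⟨(y.2, -y.1), by simp [perp]⟩
    rw [mem_polytopeEdge_polygonDivisor hΩ hΛ hpar, ← hmem, segment_eq_image',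
      add_sub_cancel_left] at hx hy
    rw [← perp_sub, ← perp_smul] at hxy
    have hab := perp_injective hxy
    obtain ⟨s, ⟨hs0, hs1⟩, rfl⟩ := hx
    obtain ⟨t, ⟨ht0, ht1⟩, rfl⟩ := hy
    have e : ((t - s) * c) • toR ρ =
        intersection (polygonDivisor (slopes Ω) Λ) (boundaryDivisor ρ) • toR ρ := by
      rw [← hab]; module
    rw [← smul_left_injective ℝ (toR_ne_zero ρ.2.1) e]
    nlinarith

theorem exists_smul_mem_edgeVectors_of_intersection_ne_zero (hΩ : IsRationalPolygon Ω)
    (hΛ : IsPolygon Λ) (hpar : EdgesParallel Λ Ω) {ρ : slopes Ω}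
    (h : intersection (polygonDivisor (slopes Ω) Λ) (boundaryDivisor ρ) ≠ 0) :
    ∃ c : ℝ, 0 < c ∧ c • toR ρ ∈ edgeVectors Λ := by
  obtain ⟨x, hx, y, hy, hxy⟩ := exists_mem_polytopeEdge_sub_eq hΩ.isCompleteFan_slopes
    (intersection_polygonDivisor_nonneg hΩ hΛ hpar) ρ
  obtain ⟨a, rfl⟩ : ∃ a, perp a = x := ⟨(x.2, -x.1), by simp [perp]⟩
  obtain ⟨b, rfl⟩ : ∃ b, perp b = y := ⟨(y.2, -y.1), by simp [perp]⟩
  rw [← perp_sub, ← perp_smul] at hxy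
  have hab := perp_injective hxy
  rw [mem_polytopeEdge_polygonDivisor hΩ hΛ hpar] at hx hy
  refine exists_smul_mem_edgeVectors hΛ.convex hΛ.isCompact (toR_ne_zero ρ.2.1) ?_ hx hy
  rintro rfl
  rw [sub_self] at hab
  exact smul_ne_zero h (toR_ne_zero ρ.2.1) hab.symm

theorem omegaPerimeter_eq_intersection (hΩ : IsRationalPolygon Ω) (hΛ : IsPolygon Λ)
    (hpar : EdgesParallel Λ Ω) :
    omegaPerimeter Ω Λ =
      intersection (polygonDivisor (slopes Ω) Λ) (polygonDivisor (slopes Ω) Ω) := by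
  have hR := hΩ.isCompleteFan_slopes
  have := hR.finite.fintype
  set t : slopes Ω → ℝ := fun ρ =>
    intersection (polygonDivisor (slopes Ω) Λ) (boundaryDivisor ρ) with ht
  have hpos : ∀ ρ, t ρ ≠ 0 → 0 < t ρ := fun ρ h =>
    lt_of_le_of_ne (intersection_polygonDivisor_nonneg hΩ hΛ hpar ρ) h.symm
  -- The edges of `Λ` correspond to the slopes with nonzero intersection number; the other slopes
  -- contribute nothing to `D_Λ · D_Ω`.
  have hbij : Set.BijOn (fun ρ => t ρ • toR ρ) {ρ | t ρ ≠ 0} (edgeVectors Λ) := by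
    refine ⟨fun ρ hρ => ?_, fun ρ hρ τ hτ h => ?_, fun e he => ?_⟩
    · obtain ⟨c, hc, h⟩ := exists_smul_mem_edgeVectors_of_intersection_ne_zero hΩ hΛ hpar hρ
      rwa [eq_intersection_of_smul_mem_edgeVectors hΩ hΛ hpar hc h] at h
    · have h1 := hpos ρ hρ
      have h2 := hpos τ hτ
      refine Subtype.ext (eq_of_toR_eq_smul ρ.2.1 τ.2.1 (r := (t ρ)⁻¹ * t τ) (by positivity) ?_)
      simp only at h
      rw [mul_smul, ← h, inv_smul_smul₀ h1.ne']
    · obtain ⟨v, hv, c, hc, rfl⟩ := hpar.exists_slope hΩ he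
      have hcv := eq_intersection_of_smul_mem_edgeVectors hΩ hΛ hpar (ρ := ⟨v, hv⟩) hc he
      refine ⟨⟨v, hv⟩, ?_, ?_⟩
      · simp only [Set.mem_ofPred_eq, ht, ← hcv]
        exact hc.ne'
      · simp only [ht, ← hcv]
  rw [omegaPerimeter, ← finsum_mem_eq_of_bijOn _ hbij
    (f := fun ρ => polygonDivisor (slopes Ω) Ω ρ * t ρ), intersection_eq_sum_boundaryDivisor,
    ← finsum_eq_sum_of_fintype]
  · refine finsum_congr fun ρ => ?_
    change _ = polygonDivisor (slopes Ω) Ω ρ * t ρ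
    by_cases h : t ρ = 0 <;> simp [h]
  · intro ρ hρ
    rw [hΩ.isPolygon.omegaLength_smul (hpos ρ hρ), polygonDivisor, mul_comm]

end

theorem mainTheorem8 :
    -- on a projective toric surface, nef divisors are characterized by their edge lengths
    (∀ R : Set (ℤ × ℤ), IsCompleteFan R → ∀ D : RDivisor R,
      (IsNef D ↔ ∀ ρ : R,
        intersection D (boundaryDivisor ρ) = latticeLength ρ (polytopeEdge D ρ)) ∧
      (IsNef D → ∀ ρ : R, (polytopeEdge D ρ).Nonempty)) ∧
    -- the `Ω`-perimeter is an intersection number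
    (∀ Ω Λ : Set (ℝ × ℝ), IsRationalPolygon Ω → IsPolygon Λ → EdgesParallel Λ Ω →
      IsCompleteFan (slopes Ω) ∧
      (IsNef (polygonDivisor (slopes Ω) Λ) ∧
        polytope (polygonDivisor (slopes Ω) Λ) = perp '' Λ) ∧
      (∀ D : RDivisor (slopes Ω), IsNef D → polytope D = perp '' Λ →
        D = polygonDivisor (slopes Ω) Λ) ∧
      omegaPerimeter Ω Λ =
        intersection (polygonDivisor (slopes Ω) Λ) (polygonDivisor (slopes Ω) Ω)) := by
  refine ⟨fun R hR D => ⟨isNef_iff_latticeLength hR D, fun hD => polytopeEdge_nonempty hR hD⟩,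
    fun Ω Λ hΩ hΛ hpar => ?_⟩
  have hR := hΩ.isCompleteFan_slopes
  exact ⟨hR, ⟨isNef_polygonDivisor hΩ hΛ hpar, polytope_polygonDivisor hΩ hΛ hpar⟩,
    fun D hD hpoly => eq_polygonDivisor_of_isNef hR hD hpoly,
    omegaPerimeter_eq_intersection hΩ hΛ hpar⟩
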